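/- Let $\Omega=(0,1]^d$ with Lebesgue measure $\mu$, let $N_L\ge 2$ and $K\ge 0$. Let $\mathcal T^K$ be the set of trees of depth $K$ obtained by starting from $\Omega$ and dividing every rectangle $A=\prod_i(a_i,b_i]$ at each level $<K$ into two children $A_l,A_r$ by cutting it in some dimension $D(A)=j\in\{1,\dots,d\}$ at the point $a_j+L(A)(b_j-a_j)$, $L(A)=l/N_L$, $l\in\{1,\dots,N_L-1\}$ ($A_l$ is the lower part). Let $\mathcal N(T)$ be the set of non-leaf nodes (levels $<K$) of $T\in\mathcal T^K$, and consider the two-group multi-resolution scanning model: * *Tree.* At the non-leaf nodes independently, $P(D(A)=j)=\lambda_j(A)$ and $P(L(A)=l/N_L)\propto\exp[-\eta\, n(A) f(|l/N_L-1/2|)]$, where $\eta\ge0$, $f:[0,\infty)\to[0,\infty)$ is increasing with $f(0)=0$, and $n(A)$ is the number of observations (of both groups) in $A$. * *States.* Given $T$, the states $V(A)\in\{1,2,3\}$, $A\in\mathcal N(T)$, form a Markov process along the tree, from parent to child, with given initial distribution at $\Omega$ and given, possibly node-dependent, transition matrices, under which state $3$ is absorbing. * *Conditional probabilities.* Given $T$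 and the states, independently over $A\in\mathcal N(T)$: if $V(A)=1$, then $\theta_1(A),\theta_2(A)$ are independent with beta priors; if $V(A)\in\{2,3\}$, then $\theta_1(A)=\theta_2(A)$ has a beta prior, the same for states $2$ and $3$. * *Data.* Given these, the observations are independent, those of group $g$ having distribution $Q_g$, where $Q_g(A_l\mid A)=\theta_g(A)$ for $A\in\mathcal N(T)$ and $Q_g(\cdot\mid A)=\mu(\cdot\mid A)$ on the leaves. Hyperparameters of the states and of the conditional probabilities may depend on $T$ and $A$. Let $Z(A)=1$ if $V(A)=1$ and $Z(A)=0$ if $V(A)\in\{2,3\}$. Suppose that the data $\mathbf x_n$ of total size $n=n_1+n_2$ in fact consist of independent observations, $n_g$ of them with distribution $P_g$ ($g=1,2$), where $n_g/n\to\zeta_g\in(0,1]$ as $n\to\infty$, and where $P_g\ll\mu$ with density $dP_g/d\mu$ positive $\mu$-almost everywhere on $\Omega$. (i) Let $T\in\mathcal T^K$ be such that $P(Z(A)=z(A)\text{ for all }A\in\mathcal N(T)\mid T)>0$ for every $z:\mathcal N(T)\to\{0,1\}$. Then, as $n\to\infty$, $$P\bigl(Z(A)=\mathbf 1_{\{P_1(A_l\mid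 A)\ne P_2(A_l\mid A)\}}\text{ for all }A\in\mathcal N(T)\,\big|\,T,\mathbf x_n\bigr)\xrightarrow{p}1 .$$ (ii) If this positivity holds for every $T\in\mathcal T^K$, then also, with $T$ random (integrated out over its posterior), as $n\to\infty$, $$P\bigl(Z(A)=\mathbf 1_{\{P_1(A_l\mid A)\ne P_2(A_l\mid A)\}}\text{ for all }A\in\mathcal N(T)\,\big|\,\mathbf x_n\bigr)\xrightarrow{p}1 .$$ -/

import Mathlib

open MeasureTheory ProbabilityTheory Filter Topology

noncomputable section

namespace PolyaTree

/-! ### Rectangles, splits and finite dyadic partition trees -/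

/-- Left or right child. -/
inductive Side
  | left
  | right
  deriving DecidableEq

instance : Fintype Side := ⟨{.left, .right}, fun b => by cases b <;> simp⟩

/-- A rectangle `(a₁, b₁] × ⋯ × (a_d, b_d]`, given by its two corners. -/
structure Rect (d : ℕ) where
  lower : Fin d → ℝ
  upper : Fin d → ℝ

/-- The point set of a rectangle. -/
def Rect.toSet {d : ℕ} (A : Rect d) : Set (Fin d → ℝ) :=
  Set.pi Set.univ fun i => Set.Ioc (A.lower i) (A.upper i)

/-- The sample space `Ω = (0, 1]^d`. -/
def unitRect (d : ℕ) : Rect d := ⟨fun _ => 0, fun _ => 1⟩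

/-- The reference measure `μ`: Lebesgue measure on `(0, 1]^d`. -/
def refMeasure (d : ℕ) : Measure (Fin d → ℝ) := volume.restrict (unitRect d).toSet

/-- A splitting decision `(D(A), L(A)) = (j, l / N_L)` with `l ∈ {1, …, N_L - 1}`. -/
abbrev Split (d NL : ℕ) := Fin d × ↥(Finset.Ioo 0 NL)

/-- The relative location `l / N_L` of a split. -/
def Split.loc {d NL : ℕ} (J : Split d NL) : ℝ := ((J.2 : ℕ) : ℝ) / (NL : ℝ)

/-- The two children of a rectangle under a splitting decision. -/
def Rect.child {d NL : ℕ} (A : Rect d) (J : Split d NL) : Side → Rect d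
  | .left =>
      ⟨A.lower,
        Function.update A.upper J.1 (A.lower J.1 + J.loc * (A.upper J.1 - A.lower J.1))⟩
  | .right =>
      ⟨Function.update A.lower J.1 (A.lower J.1 + J.loc * (A.upper J.1 - A.lower J.1)),
        A.upper⟩

/-- Address of a non-leaf node of a tree of depth `K`: the list of turns leading to the node from
the root, the most recent turn first, so that `[]` is the root and `b :: s` is the `b`-child
of `s`. -/
abbrev Inner (K : ℕ) := {s : List Side // s.length < K}

/-- Address of a leaf (a node in the deepest level `K`). -/
abbrev Leaf (K : ℕ) := {s : List Side // s.length = K}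

instance instFintypeInner (K : ℕ) : Fintype (Inner K) :=
  haveI : Finite (Inner K) := (List.finite_length_lt Side K).to_subtype
  Fintype.ofFinite _

instance instFintypeLeaf (K : ℕ) : Fintype (Leaf K) :=
  haveI : Finite (Leaf K) := (List.finite_length_eq Side K).to_subtype
  Fintype.ofFinite _

/-- The parent `s` of a non-leaf node `b :: s`. -/
def Inner.parent {K : ℕ} {b : Side} {s : List Side} (h : (b :: s).length < K) : Inner K :=
  ⟨s, Nat.lt_of_succ_lt h⟩

/-- The trees of depth `K`: one splitting decision for every non-leaf node. -/
abbrev Tree (d NL K : ℕ) := Inner K → Split d NL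

/-- The rectangle sitting at an address of the tree. -/
def rect {d NL K : ℕ} (T : Tree d NL K) : (s : List Side) → s.length ≤ K → Rect d
  | [], _ => unitRect d
  | b :: s, h => (rect T s (Nat.le_of_succ_le h)).child (T ⟨s, h⟩) b

/-- The rectangle `A` of a non-leaf node. -/
def nodeRect {d NL K : ℕ} (T : Tree d NL K) (A : Inner K) : Rect d :=
  rect T A.1 (Nat.le_of_lt A.2)

/-- The children `A_l`, `A_r` of a non-leaf node. -/
def childRect {d NL K : ℕ} (T : Tree d NL K) (A : Inner K) (b : Side) : Rect d :=
  rect T (b :: A.1) A.2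

/-- The rectangle of a leaf. -/
def leafRect {d NL K : ℕ} (T : Tree d NL K) (A : Leaf K) : Rect d :=
  rect T A.1 (Nat.le_of_eq A.2)

/-! ### The random measure attached to a tree and its conditional probabilities -/

/-- `Q(A)` when the conditional probabilities of the left children are
`θ(A) = Q(A_l | A) = 1 - Q(A_r | A)`. -/
def mass {K : ℕ} (θ : Inner K → ℝ) : (s : List Side) → s.length ≤ K → ℝ
  | [], _ => 1
  | .left :: s, h => mass θ s (Nat.le_of_succ_le h) * θ ⟨s, h⟩
  | .right :: s, h => mass θ s (Nat.le_of_succ_le h) * (1 - θ ⟨s, h⟩)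

/-- The density with respect to `μ` of the measure `Q` with conditional probabilities `θ` along `T`
and the uniform distribution `μ(· | A)` on every leaf `A`. -/
def density {d NL K : ℕ} (T : Tree d NL K) (θ : Inner K → ℝ) (x : Fin d → ℝ) : ℝ :=
  ∑ A : Leaf K, (leafRect T A).toSet.indicator
    (fun _ => mass θ A.1 (Nat.le_of_eq A.2) / (refMeasure d).real (leafRect T A).toSet) x

/-! ### The two-group multi-resolution scanning model -/

/-- The latent states: `one` (the two groups have separate conditional probabilities), `two` (they
share a conditional probability), `three` (as `two`, and absorbing along the tree). -/
inductive State
  | one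
  | two
  | three
  deriving DecidableEq

instance : Fintype State := ⟨{.one, .two, .three}, fun i => by cases i <;> simp⟩

/-- The difference indicator `Z(A)` as a function of `V(A)`. -/
def State.Z : State → Fin 2
  | .one => 1
  | .two => 0
  | .three => 0

/-- Hyperparameters of the two-group multi-resolution scanning model with flexible partitions on
`(0, 1]^d`, with location grid `{1/N_L, …, (N_L - 1)/N_L}` and maximum depth `K`. As the latent
states and conditional probabilities are modelled given the tree, their hyperparameters may depend
on the tree. -/
structure MRS (d NL K : ℕ) where
  /-- the prior probabilities `λ_j(A)` of the dimension to divide -/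
  dimProb : Inner K → Rect d → Fin d → ℝ
  dimProb_nonneg : ∀ s A j, 0 ≤ dimProb s A j
  dimProb_sum : ∀ s A, ∑ j, dimProb s A j = 1
  /-- the strength `η` of the penalty on unbalanced splits -/
  eta : ℝ
  eta_nonneg : 0 ≤ eta
  /-- the increasing function `f` in the prior on the location to divide -/
  f : ℝ → ℝ
  f_mono : MonotoneOn f (Set.Ici 0)
  f_zero : f 0 = 0
  /-- the initial distribution of the latent state of the root -/
  init : Tree d NL K → State → ℝ
  init_nonneg : ∀ T i, 0 ≤ init T i
  init_sum : ∀ T, ∑ i, init T i = 1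
  /-- the transition probabilities `ξ_{i,i'}(A) = P(V(A) = i' | V(A^p) = i)`; their values at the
  root are not used -/
  trans : Tree d NL K → Inner K → State → State → ℝ
  trans_nonneg : ∀ T A i i', 0 ≤ trans T A i i'
  trans_sum : ∀ T A i, ∑ i', trans T A i i' = 1
  trans_absorbing : ∀ T A, trans T A .three .three = 1
  /-- beta parameters of `θ_g(A)` under state `one` -/
  sepPar : Tree d NL K → Inner K → Fin 2 → Side → ℝ
  sepPar_pos : ∀ T A g b, 0 < sepPar T A g b
  /-- beta parameters of the common value `θ_1(A) = θ_2(A)` under states `two` and `three` -/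
  comPar : Tree d NL K → Inner K → Side → ℝ
  comPar_pos : ∀ T A b, 0 < comPar T A b

/-- Two samples in `ℝ^d`, of sizes `m 0` and `m 1`. -/
abbrev Sample (d : ℕ) (m : Fin 2 → ℕ) := (g : Fin 2) → Fin (m g) → Fin d → ℝ

/-- `n(A)`: the number of observations in `A`, over both groups. -/
def Sample.count {d : ℕ} {m : Fin 2 → ℕ} (x : Sample d m) (A : Rect d) : ℕ :=
  ∑ g, Set.ncard {i : Fin (m g) | x g i ∈ A.toSet}

namespace MRS

variable {d NL K : ℕ} (M : MRS d NL K) {m : Fin 2 → ℕ}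

/-- The unnormalized prior weight `exp(-η n(A) f(|l / N_L - 1/2|))` of a location. -/
def locWeight (x : Sample d m) (A : Rect d) (l : ℕ) : ℝ :=
  Real.exp (-(M.eta * (x.count A : ℝ) * M.f |(l : ℝ) / (NL : ℝ) - 1 / 2|))

/-- The prior probability of a tree: independent dimensions and locations at its non-leaf nodes
(it depends on the observations through the numbers `n(A)`). -/
def treePrior (x : Sample d m) (T : Tree d NL K) : ℝ :=
  ∏ A : Inner K, M.dimProb A (nodeRect T A) (T A).1 *
    (M.locWeight x (nodeRect T A) (T A).2 /
      ∑ l ∈ Finset.Ioo 0 NL, M.locWeight x (nodeRect T A) l)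

/-- The factor of a node in the Markov prior of the latent states. -/
def stateFactor (T : Tree d NL K) (v : Inner K → State) : Inner K → ℝ
  | ⟨[], h⟩ => M.init T (v ⟨[], h⟩)
  | ⟨b :: s, h⟩ => M.trans T ⟨b :: s, h⟩ (v (Inner.parent h)) (v ⟨b :: s, h⟩)

/-- The Markov prior probability `P(V = v | T)`. -/
def statePrior (T : Tree d NL K) (v : Inner K → State) : ℝ :=
  ∏ A : Inner K, M.stateFactor T v A

/-- The prior probability `P(Z = z | T)` of a configuration of difference indicators. -/
def indicatorPrior (T : Tree d NL K) (z : Inner K → Fin 2) : ℝ :=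
  ∑ v : Inner K → State, Set.indicator {v | ∀ A, (v A).Z = z A} (M.statePrior T) v

/-- The prior of `(θ_1(A), θ_2(A))` given `T` and `V(A)`. -/
def nodePrior (T : Tree d NL K) (A : Inner K) : State → Measure (Fin 2 → ℝ)
  | .one => Measure.pi fun g => betaMeasure (M.sepPar T A g .left) (M.sepPar T A g .right)
  | _ => (betaMeasure (M.comPar T A .left) (M.comPar T A .right)).map fun t _ => t

/-- The prior of all `(θ_1(A), θ_2(A))` given `T` and `V = v`: independent over the nodes. -/
def thetaPrior (T : Tree d NL K) (v : Inner K → State) : Measure (Inner K → Fin 2 → ℝ) :=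
  Measure.pi fun A => M.nodePrior T A (v A)

/-- The likelihood `P(x | T, θ)`: given `Q_1, Q_2`, the observations are independent, those of
group `g` with distribution `Q_g`. -/
def likelihood (T : Tree d NL K) (x : Sample d m) (θ : Inner K → Fin 2 → ℝ) : ℝ :=
  ∏ g, ∏ i, density T (fun A => θ A g) (x g i)

/-- The marginal likelihood `P(x | T, V = v)`, with `θ` integrated out. -/
def marginalLikelihood (x : Sample d m) (T : Tree d NL K) (v : Inner K → State) : ℝ :=
  ∫ θ, likelihood T x θ ∂(M.thetaPrior T v)

/-- `P(V = v, x | T)`. -/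
def joint (x : Sample d m) (T : Tree d NL K) (v : Inner K → State) : ℝ :=
  M.statePrior T v * M.marginalLikelihood x T v

/-- The posterior probability `P(V ∈ E | T, x)`. -/
def posteriorGivenTree (x : Sample d m) (T : Tree d NL K) (E : Set (Inner K → State)) : ℝ :=
  (∑ v, E.indicator (M.joint x T) v) / ∑ v, M.joint x T v

/-- The posterior probability `P(V ∈ E(T) | x)` with the tree `T` random. -/
def posterior (x : Sample d m) (E : Tree d NL K → Set (Inner K → State)) : ℝ :=
  (∑ T, M.treePrior x T * ∑ v, (E T).indicator (M.joint x T) v) /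
    ∑ T, M.treePrior x T * ∑ v, M.joint x T v

end MRS

open Classical in
/-- The indicator of `P_1(A_l | A) ≠ P_2(A_l | A)`, for the true measures `P_1, P_2`. -/
def trueDifference {d NL K : ℕ} (P : Fin 2 → Measure (Fin d → ℝ)) (T : Tree d NL K)
    (A : Inner K) : Fin 2 :=
  if (P 0)[|(nodeRect T A).toSet] (childRect T A .left).toSet ≠
      (P 1)[|(nodeRect T A).toSet] (childRect T A .left).toSet then 1 else 0

/-- The state configurations with `Z(A)` equal to the true difference indicator at every non-leaf
node `A` of `T`. -/
def correctStates {d NL K : ℕ} (P : Fin 2 → Measure (Fin d → ℝ)) (T : Tree d NL K) :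
    Set (Inner K → State) :=
  {v | ∀ A, (v A).Z = trueDifference P T A}

end PolyaTree

end

noncomputable section

namespace PolyaTree

/-! ### Asymptotics of the beta function -/

/-! Fix a tree. The likelihood is a factor free of `θ` times, over nodes and groups, `θ ^ k * (1 -
θ) ^ l`, where `k` and `l` count the observations in the two children. Beta priors are conjugate, so
integrating `θ` out gives a product over nodes of ratios of beta functions
(`marginalLikelihood_eq`). The posterior odds of two state configurations are thus their prior odds
times a product of nodewise Bayes factors, each comparing separate with shared conditional
probabilities.

By Stirling's formula the log Bayes factor at a node is the log-likelihood ratio statistic minus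
`log n / 2`, up to a convergent term (`exists_tendsto_log_bayesFactor`). If the true conditional
probabilities agree and the counts are within `C √n` of their means, the statistic is bounded by a
Pearson chi-square, so `log n / 2` wins and the shared model is chosen (`bayesFactor_tendsto_zero`).
If they differ, strictness in Gibbs' inequality makes the statistic grow linearly in `n`, and the
separate model is chosen (`bayesFactor_inv_tendsto_zero`). Hence every configuration with a wrong
indicator vanishes relative to the correct ones, which keep their prior proportions. Positive prior
probability of the true indicator pattern then makes the posterior tend to one.

The randomness enters only through Chebyshev's inequality: for large `C` all counts are within `C
√n` of their means with probability close to one. The limits are taken along a filter on pairs `(n,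
ω)` with `ω` in this event, which is why the analytic lemmas allow an arbitrary filter `F`.

For a random tree, the posterior probability is an average of the finitely many posterior
probabilities given a tree. All of these tend to one, so nothing need be known about the
data-dependent weights. -/

theorem Gamma_add_nat {a : ℝ} (ha : 0 < a) (n : ℕ) :
    Real.Gamma (a + n) = Real.Gamma a * ∏ j ∈ Finset.range n, (a + j) := by
  induction n with
  | zero => simp
  | succ n ih =>
    rw [Finset.prod_range_succ, Nat.cast_succ, ← add_assoc, Real.Gamma_add_one (by positivity), ih]
    ring

/-- Euler's limit formula for `Γ(a)` expresses `Γ(a + k)` through `k!` and `k ^ a`, and Stirling's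
formula handles `k!`. The value of the limit is never needed. -/
theorem exists_tendsto_log_Gamma {a : ℝ} (ha : 0 < a) :
    ∃ c, Tendsto (fun k : ℕ => Real.log (Real.Gamma (a + k)) -
      (k * Real.log k - k + (a - 1 / 2) * Real.log k)) atTop (𝓝 c) := by
  have hΓ := Real.Gamma_pos_of_pos ha
  have h1 := (Real.GammaSeq_tendsto_Gamma a).log hΓ.ne'
  have h2 := Stirling.tendsto_stirlingSeq_sqrt_pi.log (by positivity)
  have h3 : Tendsto (fun k : ℕ => Real.log ((a + k) / k)) atTop (𝓝 0) := by
    have : Tendsto (fun k : ℕ => a / (k : ℝ) + 1) atTop (𝓝 (0 + 1)) :=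
      (tendsto_const_div_atTop_nhds_zero_nat a).add_const 1
    rw [zero_add] at this
    rw [← Real.log_one]
    refine (this.congr' ?_).log one_ne_zero
    filter_upwards [eventually_gt_atTop 0] with k hk
    field_simp
  refine ⟨_, ((((h2.add_const (1 / 2 * Real.log 2)).add_const (Real.log (Real.Gamma a))).sub
    h1).sub h3).congr' ?_⟩
  filter_upwards [eventually_gt_atTop 0] with k hk
  have hk' : (0 : ℝ) < k := by exact_mod_cast hk
  have hak : 0 < a + k := by positivity
  have hG : Real.Gamma (a + k) = Real.Gamma a * (∏ j ∈ Finset.range (k + 1), (a + j)) / (a + k) := by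
    rw [Gamma_add_nat ha, Finset.prod_range_succ]
    field_simp
  have hp : 0 < ∏ j ∈ Finset.range (k + 1), (a + (j : ℝ)) :=
    Finset.prod_pos fun j _ => by positivity
  rw [hG, Real.log_div (by positivity) hak.ne', Real.log_mul hΓ.ne' hp.ne', Real.log_div hak.ne' hk'.ne',
    Stirling.log_stirlingSeq_formula, Real.GammaSeq, Real.log_div (by positivity) hp.ne',
    Real.log_mul two_ne_zero hk'.ne', Real.log_mul (by positivity) (by positivity),
    Real.log_rpow hk', Real.log_div hk'.ne' (Real.exp_ne_zero 1), Real.log_exp]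
  ring

/-! ### Binomial log-likelihoods and Gibbs' inequality -/

/-- The maximum of `x log t + y log (1 - t)` over `t`. -/
def maxLogLik (x y : ℝ) : ℝ := x * Real.log x + y * Real.log y - (x + y) * Real.log (x + y)

theorem maxLogLik_smul {n x y : ℝ} (hn : 0 < n) (hx : 0 < x) (hy : 0 < y) :
    maxLogLik (n * x) (n * y) = n * maxLogLik x y := by
  unfold maxLogLik
  rw [← mul_add, Real.log_mul hn.ne' hx.ne', Real.log_mul hn.ne' hy.ne',
    Real.log_mul hn.ne' (by positivity)]
  ring

/-- The loss from using `t` in place of the maximizer `x / (x + y)` is `x + y` times a Bernoulli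
Kullback–Leibler divergence. -/
theorem maxLogLik_sub_eq {x y t : ℝ} (hx : 0 < x) (hy : 0 < y) (ht : 0 < t) (ht' : t < 1) :
    maxLogLik x y - (x * Real.log t + y * Real.log (1 - t)) =
      x * Real.log (x / ((x + y) * t)) + y * Real.log (y / ((x + y) * (1 - t))) := by
  have : 0 < 1 - t := by linarith
  unfold maxLogLik
  rw [Real.log_div hx.ne' (by positivity), Real.log_div hy.ne' (by positivity),
    Real.log_mul (by positivity) (by positivity), Real.log_mul (by positivity) (by positivity)]
  ring

/-- The inequality `log u ≤ u - 1` bounds the divergence by Pearson's chi-square statistic, since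
`(1 - t) * x - t * y = x - (x + y) * t`. -/
theorem maxLogLik_sub_le {x y t : ℝ} (hx : 0 < x) (hy : 0 < y) (ht : 0 < t) (ht' : t < 1) :
    maxLogLik x y - (x * Real.log t + y * Real.log (1 - t)) ≤
      ((1 - t) * x - t * y) ^ 2 / ((x + y) * (t * (1 - t))) := by
  have h1 : 0 < 1 - t := by linarith
  rw [maxLogLik_sub_eq hx hy ht ht']
  have e1 := mul_le_mul_of_nonneg_left
    (Real.log_le_sub_one_of_pos (x := x / ((x + y) * t)) (by positivity)) hx.le
  have e2 := mul_le_mul_of_nonneg_left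
    (Real.log_le_sub_one_of_pos (x := y / ((x + y) * (1 - t))) (by positivity)) hy.le
  refine (add_le_add e1 e2).trans_eq ?_
  field_simp
  ring

/-- Termwise Gibbs inequality: the linear lower bounds for the two outcomes cancel when both sides
have the same total. -/
theorem mul_log_div_gt {x u : ℝ} (hx : 0 < x) (hu : 0 < u) (hne : x ≠ u) :
    x - u < x * Real.log (x / u) := by
  have h := Real.log_lt_sub_one_of_pos (x := u / x) (by positivity)
    (fun h => hne ((div_eq_one_iff_eq hx.ne').1 h).symm)
  rw [← inv_div x u, Real.log_inv, inv_div] at h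
  have := mul_lt_mul_of_pos_left h hx
  have e : x * (u / x - 1) = u - x := by field_simp
  linarith

theorem mul_log_div_ge {x u : ℝ} (hx : 0 < x) (hu : 0 < u) :
    x - u ≤ x * Real.log (x / u) := by
  rcases eq_or_ne x u with rfl | h
  · simp [hx.ne']
  · exact (mul_log_div_gt hx hu h).le

theorem le_maxLogLik {x y t : ℝ} (hx : 0 < x) (hy : 0 < y) (ht : 0 < t) (ht' : t < 1) :
    x * Real.log t + y * Real.log (1 - t) ≤ maxLogLik x y := by
  have h1 : 0 < 1 - t := by linarith
  have := maxLogLik_sub_eq hx hy ht ht'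
  have e1 := mul_log_div_ge hx (u := (x + y) * t) (by positivity)
  have e2 := mul_log_div_ge hy (u := (x + y) * (1 - t)) (by positivity)
  linarith

theorem lt_maxLogLik {x y t : ℝ} (hx : 0 < x) (hy : 0 < y) (ht : 0 < t) (ht' : t < 1)
    (hne : x ≠ (x + y) * t) :
    x * Real.log t + y * Real.log (1 - t) < maxLogLik x y := by
  have h1 : 0 < 1 - t := by linarith
  have := maxLogLik_sub_eq hx hy ht ht'
  have e1 := mul_log_div_gt hx (u := (x + y) * t) (by positivity) hne
  have e2 := mul_log_div_ge hy (u := (x + y) * (1 - t)) (by positivity)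
  linarith

theorem maxLogLik_eq {x y : ℝ} (hx : 0 < x) (hy : 0 < y) :
    maxLogLik x y = x * Real.log (x / (x + y)) + y * Real.log (1 - x / (x + y)) := by
  have : 1 - x / (x + y) = y / (x + y) := by field_simp; ring
  rw [this, Real.log_div hx.ne' (by positivity), Real.log_div hy.ne' (by positivity), maxLogLik]
  ring

theorem maxLogLik_add_lt {x₁ y₁ x₂ y₂ : ℝ} (hx₁ : 0 < x₁) (hy₁ : 0 < y₁) (hx₂ : 0 < x₂)
    (hy₂ : 0 < y₂) (hne : x₁ / (x₁ + y₁) ≠ x₂ / (x₂ + y₂)) :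
    maxLogLik (x₁ + x₂) (y₁ + y₂) < maxLogLik x₁ y₁ + maxLogLik x₂ y₂ := by
  rw [maxLogLik_eq (by positivity) (by positivity)]
  set t := (x₁ + x₂) / (x₁ + x₂ + (y₁ + y₂)) with ht
  have ht0 : 0 < t := by positivity
  have ht1 : t < 1 := by rw [ht, div_lt_one (by positivity)]; linarith
  -- The pooled fraction `t` is a weighted mean of the two group fractions, so if it equalled the
  -- first it would equal the second too.
  have h1 : x₁ ≠ (x₁ + y₁) * t := by
    intro h
    apply hne
    rw [ht] at h
    field_simp at h ⊢
    linarith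
  have := lt_maxLogLik hx₁ hy₁ ht0 ht1 h1
  have := le_maxLogLik hx₂ hy₂ ht0 ht1
  nlinarith

theorem tendsto_natCast_of_div {ι : Type*} {F : Filter ι} {n : ι → ℝ} (hn : Tendsto n F atTop)
    {k : ι → ℕ} {κ : ℝ} (hκ : 0 < κ) (hk : Tendsto (fun i => k i / n i) F (𝓝 κ)) :
    Tendsto k F atTop := by
  rw [← tendsto_natCast_atTop_iff (R := ℝ)]
  refine (hk.pos_mul_atTop hκ hn).congr' ?_
  filter_upwards [hn.eventually_gt_atTop 0] with i hi
  field_simp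

/-- Replacing `log k` by `log n + log (k / n)`, the coefficients `a - 1/2`, `b - 1/2` and `-(a + b -
1/2)` of `log n` add up to `-1/2`. -/
theorem exists_tendsto_log_beta {ι : Type*} {F : Filter ι} {n : ι → ℝ} (hn : Tendsto n F atTop)
    {k l : ι → ℕ} {κ lam : ℝ} (hκ : 0 < κ) (hlam : 0 < lam)
    (hk : Tendsto (fun i => k i / n i) F (𝓝 κ)) (hl : Tendsto (fun i => l i / n i) F (𝓝 lam))
    {a b : ℝ} (ha : 0 < a) (hb : 0 < b) :
    ∃ c, Tendsto (fun i => Real.log (beta (a + k i) (b + l i)) -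
      (maxLogLik (k i) (l i) - 1 / 2 * Real.log (n i))) F (𝓝 c) := by
  have hkn := tendsto_natCast_of_div hn hκ hk
  have hln := tendsto_natCast_of_div hn hlam hl
  have hkl : Tendsto (fun i => ((k i + l i : ℕ) : ℝ) / n i) F (𝓝 (κ + lam)) :=
    (hk.add hl).congr fun i => by push_cast; ring
  have hkln := tendsto_natCast_of_div hn (add_pos hκ hlam) hkl
  obtain ⟨c₁, h₁⟩ := exists_tendsto_log_Gamma ha
  obtain ⟨c₂, h₂⟩ := exists_tendsto_log_Gamma hb
  obtain ⟨c₃, h₃⟩ := exists_tendsto_log_Gamma (add_pos ha hb)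
  refine ⟨_, ((((h₁.comp hkn).add (h₂.comp hln)).sub (h₃.comp hkln)).add
    ((((hk.log hκ.ne').const_mul (a - 1 / 2)).add ((hl.log hlam.ne').const_mul (b - 1 / 2))).sub
    ((hkl.log (by positivity)).const_mul (a + b - 1 / 2)))).congr' ?_⟩
  filter_upwards [hn.eventually_gt_atTop 0, hkn.eventually_gt_atTop 0, hln.eventually_gt_atTop 0]
    with i hni hki hli
  have hki' : (0 : ℝ) < k i := by exact_mod_cast hki
  have hli' : (0 : ℝ) < l i := by exact_mod_cast hli
  have e : a + b + ((k i + l i : ℕ) : ℝ) = a + k i + (b + l i) := by push_cast; ring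
  have g₁ := Real.Gamma_pos_of_pos (add_pos ha hki')
  have g₂ := Real.Gamma_pos_of_pos (add_pos hb hli')
  have g₃ := Real.Gamma_pos_of_pos (add_pos (add_pos ha hki') (add_pos hb hli'))
  simp only [Function.comp_apply, e]
  push_cast
  rw [beta, Real.log_div (by positivity) g₃.ne', Real.log_mul g₁.ne' g₂.ne',
    Real.log_div hki'.ne' hni.ne', Real.log_div hli'.ne' hni.ne',
    Real.log_div (by positivity) hni.ne', maxLogLik]
  ring

/-! ### Bayes factors -/

/-- Marginal likelihood of `k` and `l` turns under a beta prior. -/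
def betaRatio (a b : ℝ) (k l : ℕ) : ℝ := beta (a + k) (b + l) / beta a b

theorem betaRatio_pos {a b : ℝ} (ha : 0 < a) (hb : 0 < b) (k l : ℕ) : 0 < betaRatio a b k l :=
  div_pos (beta_pos (by positivity) (by positivity)) (beta_pos ha hb)

/-- The log Bayes factor is asymptotic to the log-likelihood ratio statistic minus
`log n / 2`. -/
theorem exists_tendsto_log_bayesFactor {ι : Type*} {F : Filter ι} {n : ι → ℝ}
    (hn : Tendsto n F atTop) {k l : Fin 2 → ι → ℕ} {κ lam : Fin 2 → ℝ} (hκ : ∀ g, 0 < κ g)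
    (hlam : ∀ g, 0 < lam g) (hk : ∀ g, Tendsto (fun i => k g i / n i) F (𝓝 (κ g)))
    (hl : ∀ g, Tendsto (fun i => l g i / n i) F (𝓝 (lam g)))
    {a b : Fin 2 → ℝ} (ha : ∀ g, 0 < a g) (hb : ∀ g, 0 < b g) {a' b' : ℝ} (ha' : 0 < a')
    (hb' : 0 < b') :
    ∃ c, Tendsto (fun i => Real.log ((∏ g, betaRatio (a g) (b g) (k g i) (l g i)) /
        betaRatio a' b' (∑ g, k g i) (∑ g, l g i)) -
      (maxLogLik (k 0 i) (l 0 i) + maxLogLik (k 1 i) (l 1 i) -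
        maxLogLik (k 0 i + k 1 i) (l 0 i + l 1 i) - 1 / 2 * Real.log (n i))) F (𝓝 c) := by
  obtain ⟨c₁, h₁⟩ := exists_tendsto_log_beta hn (hκ 0) (hlam 0) (hk 0) (hl 0) (ha 0) (hb 0)
  obtain ⟨c₂, h₂⟩ := exists_tendsto_log_beta hn (hκ 1) (hlam 1) (hk 1) (hl 1) (ha 1) (hb 1)
  obtain ⟨c₃, h₃⟩ := exists_tendsto_log_beta hn (add_pos (hκ 0) (hκ 1))
    (add_pos (hlam 0) (hlam 1)) (k := fun i => k 0 i + k 1 i) (l := fun i => l 0 i + l 1 i)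
    (((hk 0).add (hk 1)).congr fun i => by push_cast; ring)
    (((hl 0).add (hl 1)).congr fun i => by push_cast; ring) ha' hb'
  refine ⟨_, (((h₁.add h₂).sub h₃).sub_const (Real.log (beta (a 0) (b 0)) +
    Real.log (beta (a 1) (b 1)) - Real.log (beta a' b'))).congr fun i => ?_⟩
  have p : ∀ {a b : ℝ}, 0 < a → 0 < b → ∀ k l : ℕ, 0 < beta (a + k) (b + l) :=
    fun ha hb k l => beta_pos (by positivity) (by positivity)
  rw [Fin.prod_univ_two, Fin.sum_univ_two, Fin.sum_univ_two,
    Real.log_div (mul_pos (betaRatio_pos (ha 0) (hb 0) _ _) (betaRatio_pos (ha 1) (hb 1) _ _)).ne'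
      (betaRatio_pos ha' hb' _ _).ne',
    Real.log_mul (betaRatio_pos (ha 0) (hb 0) _ _).ne' (betaRatio_pos (ha 1) (hb 1) _ _).ne',
    betaRatio, betaRatio, betaRatio, Real.log_div (p (ha 0) (hb 0) _ _).ne'
      (beta_pos (ha 0) (hb 0)).ne', Real.log_div (p (ha 1) (hb 1) _ _).ne'
      (beta_pos (ha 1) (hb 1)).ne', Real.log_div (p ha' hb' _ _).ne' (beta_pos ha' hb').ne']
  push_cast
  ring

theorem tendsto_of_log_atBot {ι : Type*} {F : Filter ι} {f g : ι → ℝ} (hf : ∀ i, 0 < f i) {c : ℝ}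
    (h : Tendsto (fun i => Real.log (f i) - g i) F (𝓝 c)) (hg : Tendsto g F atBot) :
    Tendsto f F (𝓝 0) := by
  have : Tendsto (fun i => Real.log (f i)) F atBot :=
    (h.add_atBot hg).congr fun i => by ring
  exact (Real.tendsto_exp_atBot.comp this).congr fun i => Real.exp_log (hf i)

/-- The number `t` plays the role of the common true probability of the left child; both groups fit
it within `C √n`, which keeps the likelihood ratio statistic bounded. -/
theorem bayesFactor_tendsto_zero {ι : Type*} {F : Filter ι} {n : ι → ℝ}
    (hn : Tendsto n F atTop) {k l : Fin 2 → ι → ℕ} {κ lam : Fin 2 → ℝ} (hκ : ∀ g, 0 < κ g)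
    (hlam : ∀ g, 0 < lam g) (hk : ∀ g, Tendsto (fun i => k g i / n i) F (𝓝 (κ g)))
    (hl : ∀ g, Tendsto (fun i => l g i / n i) F (𝓝 (lam g)))
    {a b : Fin 2 → ℝ} (ha : ∀ g, 0 < a g) (hb : ∀ g, 0 < b g) {a' b' : ℝ} (ha' : 0 < a')
    (hb' : 0 < b') {t C : ℝ} (ht : 0 < t) (ht' : t < 1)
    (hC : ∀ g, ∀ᶠ i in F, |(1 - t) * k g i - t * l g i| ≤ C * √(n i)) :
    Tendsto (fun i => (∏ g, betaRatio (a g) (b g) (k g i) (l g i)) /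
        betaRatio a' b' (∑ g, k g i) (∑ g, l g i)) F (𝓝 0) := by
  obtain ⟨c, h⟩ := exists_tendsto_log_bayesFactor hn hκ hlam hk hl ha hb ha' hb'
  refine tendsto_of_log_atBot (fun i => div_pos (Finset.prod_pos fun g _ =>
    betaRatio_pos (ha g) (hb g) _ _) (betaRatio_pos ha' hb' _ _)) h ?_
  have h1 : 0 < 1 - t := by linarith
  have key : ∀ g, ∀ᶠ i in F, maxLogLik (k g i) (l g i) -
      (k g i * Real.log t + l g i * Real.log (1 - t)) ≤
        C ^ 2 / ((κ g + lam g) / 2 * (t * (1 - t))) := by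
    intro g
    have hkl := ((hk g).add (hl g)).eventually_const_lt
      (half_lt_self (add_pos (hκ g) (hlam g)))
    filter_upwards [hC g, hkl, hn.eventually_gt_atTop 0,
      (tendsto_natCast_of_div hn (hκ g) (hk g)).eventually_gt_atTop 0,
      (tendsto_natCast_of_div hn (hlam g) (hl g)).eventually_gt_atTop 0] with i hCi hi hni h2 h3
    have h2' : (0 : ℝ) < k g i := by exact_mod_cast h2
    have h3' : (0 : ℝ) < l g i := by exact_mod_cast h3
    refine (maxLogLik_sub_le h2' h3' ht ht').trans ?_
    have hs : ((1 - t) * k g i - t * l g i) ^ 2 ≤ C ^ 2 * n i := by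
      have := pow_le_pow_left₀ (abs_nonneg _) hCi 2
      rwa [sq_abs, mul_pow, Real.sq_sqrt hni.le] at this
    have hN : (κ g + lam g) / 2 * n i ≤ k g i + l g i := by
      rw [← add_div, lt_div_iff₀ hni] at hi
      exact hi.le
    have hκl := add_pos (hκ g) (hlam g)
    calc _ ≤ C ^ 2 * n i / ((κ g + lam g) / 2 * n i * (t * (1 - t))) := by gcongr
      _ = _ := by field_simp
  have hlog : Tendsto (fun i => -(1 / 2 * Real.log (n i))) F atBot :=
    tendsto_neg_atTop_atBot.comp ((Real.tendsto_log_atTop.comp hn).const_mul_atTop (by norm_num))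
  refine tendsto_atBot_mono' F ?_ (tendsto_atBot_add_const_left F
    (C ^ 2 / ((κ 0 + lam 0) / 2 * (t * (1 - t))) + C ^ 2 / ((κ 1 + lam 1) / 2 * (t * (1 - t))))
    hlog)
  filter_upwards [key 0, key 1, (tendsto_natCast_of_div hn (hκ 0) (hk 0)).eventually_gt_atTop 0,
      (tendsto_natCast_of_div hn (hlam 0) (hl 0)).eventually_gt_atTop 0] with i k0 k1 h2 h3
  have h2' : (0 : ℝ) < k 0 i := by exact_mod_cast h2
  have h3' : (0 : ℝ) < l 0 i := by exact_mod_cast h3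
  -- The pooled maximum is at least the pooled log-likelihood at `t`, so the statistic is at most
  -- the sum of the two groups' losses at `t`.
  have := le_maxLogLik (x := k 0 i + k 1 i) (y := l 0 i + l 1 i) (by positivity) (by positivity)
    ht ht'
  linarith

/-- `maxLogLik` is homogeneous of degree one and continuous at positive arguments. -/
theorem tendsto_maxLogLik_div {ι : Type*} {F : Filter ι} {n x y : ι → ℝ} (hn : Tendsto n F atTop)
    {κ lam : ℝ} (hκ : 0 < κ) (hlam : 0 < lam) (hx : Tendsto (fun i => x i / n i) F (𝓝 κ))
    (hy : Tendsto (fun i => y i / n i) F (𝓝 lam)) :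
    Tendsto (fun i => maxLogLik (x i) (y i) / n i) F (𝓝 (maxLogLik κ lam)) := by
  have : Tendsto (fun i => maxLogLik (x i / n i) (y i / n i)) F (𝓝 (maxLogLik κ lam)) :=
    ((hx.mul (hx.log hκ.ne')).add (hy.mul (hy.log hlam.ne'))).sub
      ((hx.add hy).mul ((hx.add hy).log (by positivity)))
  refine this.congr' ?_
  filter_upwards [hn.eventually_gt_atTop 0, hx.eventually_const_lt hκ, hy.eventually_const_lt hlam]
    with i hi h1 h2
  rw [eq_div_iff hi.ne', mul_comm, ← maxLogLik_smul hi h1 h2, mul_div_cancel₀ _ hi.ne',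
    mul_div_cancel₀ _ hi.ne']

/-- Divided by `n`, the statistic tends to a constant that is positive by `maxLogLik_add_lt`,
whereas `log n / n` tends to zero. -/
theorem bayesFactor_inv_tendsto_zero {ι : Type*} {F : Filter ι} {n : ι → ℝ}
    (hn : Tendsto n F atTop) {k l : Fin 2 → ι → ℕ} {κ lam : Fin 2 → ℝ} (hκ : ∀ g, 0 < κ g)
    (hlam : ∀ g, 0 < lam g) (hk : ∀ g, Tendsto (fun i => k g i / n i) F (𝓝 (κ g)))
    (hl : ∀ g, Tendsto (fun i => l g i / n i) F (𝓝 (lam g)))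
    {a b : Fin 2 → ℝ} (ha : ∀ g, 0 < a g) (hb : ∀ g, 0 < b g) {a' b' : ℝ} (ha' : 0 < a')
    (hb' : 0 < b') (hne : κ 0 / (κ 0 + lam 0) ≠ κ 1 / (κ 1 + lam 1)) :
    Tendsto (fun i => betaRatio a' b' (∑ g, k g i) (∑ g, l g i) /
      ∏ g, betaRatio (a g) (b g) (k g i) (l g i)) F (𝓝 0) := by
  obtain ⟨c, h⟩ := exists_tendsto_log_bayesFactor hn hκ hlam hk hl ha hb ha' hb'
  have hlim : Tendsto (fun i => n i * ((maxLogLik (k 0 i) (l 0 i) / n i +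
      maxLogLik (k 1 i) (l 1 i) / n i - maxLogLik (k 0 i + k 1 i) (l 0 i + l 1 i) / n i) -
      1 / 2 * (Real.log (n i) / n i))) F atTop := by
    have hlog : Tendsto (fun i => Real.log (n i) / n i) F (𝓝 0) :=
      (Real.isLittleO_log_id_atTop.tendsto_div_nhds_zero).comp hn
    have hpos := maxLogLik_add_lt (hκ 0) (hlam 0) (hκ 1) (hlam 1) hne
    refine hn.atTop_mul_pos (C := maxLogLik (κ 0) (lam 0) + maxLogLik (κ 1) (lam 1) -
      maxLogLik (κ 0 + κ 1) (lam 0 + lam 1) - 1 / 2 * 0) (by linarith) ?_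
    exact (((tendsto_maxLogLik_div hn (hκ 0) (hlam 0) (hk 0) (hl 0)).add
      (tendsto_maxLogLik_div hn (hκ 1) (hlam 1) (hk 1) (hl 1))).sub
      (tendsto_maxLogLik_div hn (add_pos (hκ 0) (hκ 1)) (add_pos (hlam 0) (hlam 1))
        (((hk 0).add (hk 1)).congr fun i => by ring)
        (((hl 0).add (hl 1)).congr fun i => by ring))).sub (hlog.const_mul _)
  refine tendsto_of_log_atBot (fun i => div_pos (betaRatio_pos ha' hb' _ _)
    (Finset.prod_pos fun g _ => betaRatio_pos (ha g) (hb g) _ _)) ?_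
    (tendsto_neg_atTop_atBot.comp (hlim.congr' ?_))
    (g := fun i => -(maxLogLik (k 0 i) (l 0 i) + maxLogLik (k 1 i) (l 1 i) -
        maxLogLik (k 0 i + k 1 i) (l 0 i + l 1 i) - 1 / 2 * Real.log (n i))) (c := -c)
  · refine h.neg.congr fun i => ?_
    rw [← inv_div, Real.log_inv]
    ring
  · filter_upwards [hn.eventually_gt_atTop 0] with i hi
    field_simp

section

/-! ### Geometry of the partition tree -/

theorem Split.loc_pos {d NL : ℕ} (J : Split d NL) : 0 < J.loc := by
  have := Finset.mem_Ioo.1 J.2.2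
  exact div_pos (by exact_mod_cast this.1) (by exact_mod_cast this.1.trans this.2)

theorem Split.loc_lt_one {d NL : ℕ} (J : Split d NL) : J.loc < 1 := by
  have := Finset.mem_Ioo.1 J.2.2
  exact (div_lt_one (by exact_mod_cast this.1.trans this.2)).2 (by exact_mod_cast this.2)

/-- A rectangle with nonempty interior. -/
def Rect.Nondegenerate {d : ℕ} (A : Rect d) : Prop := ∀ i, A.lower i < A.upper i

/-- The coordinate at which a rectangle is cut. -/
def Rect.cut {d NL : ℕ} (A : Rect d) (J : Split d NL) : ℝ :=
  A.lower J.1 + J.loc * (A.upper J.1 - A.lower J.1)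

theorem Rect.Nondegenerate.lower_lt_cut {d NL : ℕ} {A : Rect d} (hA : A.Nondegenerate)
    (J : Split d NL) : A.lower J.1 < A.cut J := by
  have := mul_pos J.loc_pos (sub_pos.2 (hA J.1))
  unfold Rect.cut
  linarith

theorem Rect.Nondegenerate.cut_lt_upper {d NL : ℕ} {A : Rect d} (hA : A.Nondegenerate)
    (J : Split d NL) : A.cut J < A.upper J.1 := by
  have := mul_lt_mul_of_pos_right J.loc_lt_one (sub_pos.2 (hA J.1))
  unfold Rect.cut
  linarith

theorem Rect.Nondegenerate.child {d NL : ℕ} {A : Rect d} (hA : A.Nondegenerate) (J : Split d NL)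
    (b : Side) : (A.child J b).Nondegenerate := by
  intro i
  rcases eq_or_ne i J.1 with rfl | hi
  · cases b
    · simpa only [Rect.child, Function.update_self, Rect.cut] using hA.lower_lt_cut J
    · simpa only [Rect.child, Function.update_self, Rect.cut] using hA.cut_lt_upper J
  · cases b <;> simpa [Rect.child, Function.update_of_ne hi] using hA i

theorem Rect.mem_child_left {d NL : ℕ} {A : Rect d} (hA : A.Nondegenerate) (J : Split d NL)
    (x : Fin d → ℝ) : x ∈ (A.child J .left).toSet ↔ x ∈ A.toSet ∧ x J.1 ≤ A.cut J := by
  simp only [Rect.toSet, Rect.child, Set.mem_pi, Set.mem_univ, true_imp_iff, Set.mem_Ioc]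
  constructor
  · intro h
    have hJ := h J.1
    rw [Function.update_self] at hJ
    refine ⟨fun i => ⟨(h i).1, ?_⟩, hJ.2⟩
    rcases eq_or_ne i J.1 with rfl | hi
    · exact hJ.2.trans (hA.cut_lt_upper J).le
    · simpa [Function.update_of_ne hi] using (h i).2
  · rintro ⟨h, hJ⟩ i
    refine ⟨(h i).1, ?_⟩
    rcases eq_or_ne i J.1 with rfl | hi
    · rwa [Function.update_self]
    · simpa [Function.update_of_ne hi] using (h i).2

theorem Rect.mem_child_right {d NL : ℕ} {A : Rect d} (hA : A.Nondegenerate) (J : Split d NL)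
    (x : Fin d → ℝ) : x ∈ (A.child J .right).toSet ↔ x ∈ A.toSet ∧ A.cut J < x J.1 := by
  simp only [Rect.toSet, Rect.child, Set.mem_pi, Set.mem_univ, true_imp_iff, Set.mem_Ioc]
  constructor
  · intro h
    have hJ := h J.1
    rw [Function.update_self] at hJ
    refine ⟨fun i => ⟨?_, (h i).2⟩, hJ.1⟩
    rcases eq_or_ne i J.1 with rfl | hi
    · exact (hA.lower_lt_cut J).trans hJ.1
    · simpa [Function.update_of_ne hi] using (h i).1
  · rintro ⟨h, hJ⟩ i
    refine ⟨?_, (h i).2⟩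
    rcases eq_or_ne i J.1 with rfl | hi
    · rwa [Function.update_self]
    · simpa [Function.update_of_ne hi] using (h i).1

theorem Rect.child_subset {d NL : ℕ} {A : Rect d} (hA : A.Nondegenerate) (J : Split d NL)
    (b : Side) : (A.child J b).toSet ⊆ A.toSet := by
  intro x hx
  cases b
  · exact ((Rect.mem_child_left hA J x).1 hx).1
  · exact ((Rect.mem_child_right hA J x).1 hx).1

theorem Rect.eq_of_mem_child {d NL : ℕ} {A : Rect d} (hA : A.Nondegenerate) (J : Split d NL)
    {x : Fin d → ℝ} {b b' : Side} (hb : x ∈ (A.child J b).toSet)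
    (hb' : x ∈ (A.child J b').toSet) : b = b' := by
  cases b <;> cases b'
  · rfl
  · exact absurd ((Rect.mem_child_right hA J x).1 hb').2
      ((Rect.mem_child_left hA J x).1 hb).2.not_gt
  · exact absurd ((Rect.mem_child_right hA J x).1 hb).2
      ((Rect.mem_child_left hA J x).1 hb').2.not_gt
  · rfl

theorem Rect.exists_mem_child {d NL : ℕ} {A : Rect d} (hA : A.Nondegenerate) (J : Split d NL)
    {x : Fin d → ℝ} (hx : x ∈ A.toSet) : ∃ b, x ∈ (A.child J b).toSet := by
  rcases le_or_gt (x J.1) (A.cut J) with h | h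
  · exact ⟨.left, (Rect.mem_child_left hA J x).2 ⟨hx, h⟩⟩
  · exact ⟨.right, (Rect.mem_child_right hA J x).2 ⟨hx, h⟩⟩

theorem Rect.measurableSet_toSet {d : ℕ} (A : Rect d) : MeasurableSet A.toSet :=
  MeasurableSet.univ_pi fun _ => measurableSet_Ioc

variable {d NL K : ℕ} (T : Tree d NL K)

theorem rect_nondegenerate : ∀ (s : List Side) (h : s.length ≤ K), (rect T s h).Nondegenerate
  | [], _ => fun _ => by simp [rect, unitRect]
  | b :: s, h => (rect_nondegenerate s (Nat.le_of_succ_le h)).child _ b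

theorem rect_cons_subset (b : Side) (s : List Side) (h : (b :: s).length ≤ K) :
    (rect T (b :: s) h).toSet ⊆ (rect T s (Nat.le_of_succ_le h)).toSet :=
  Rect.child_subset (rect_nondegenerate T s _) _ b

theorem rect_subset_unitRect : ∀ (s : List Side) (h : s.length ≤ K),
    (rect T s h).toSet ⊆ (unitRect d).toSet
  | [], _ => subset_rfl
  | b :: s, h => (rect_cons_subset T b s h).trans (rect_subset_unitRect s _)

theorem eq_of_mem_rect {x : Fin d → ℝ} : ∀ {s t : List Side} (hs : s.length ≤ K)
    (ht : t.length ≤ K), s.length = t.length → x ∈ (rect T s hs).toSet →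
    x ∈ (rect T t ht).toSet → s = t
  | [], [], _, _, _, _, _ => rfl
  | b :: s, b' :: t, hs, ht, hst, hxs, hxt => by
    obtain rfl := eq_of_mem_rect (Nat.le_of_succ_le hs) (Nat.le_of_succ_le ht)
      (Nat.succ_injective hst) (rect_cons_subset T b s hs hxs) (rect_cons_subset T b' t ht hxt)
    rw [Rect.eq_of_mem_child (rect_nondegenerate T s _) _ hxs hxt]

theorem exists_mem_rect {x : Fin d → ℝ} (hx : x ∈ (unitRect d).toSet) :
    ∀ j ≤ K, ∃ (s : List Side) (h : s.length ≤ K), s.length = j ∧ x ∈ (rect T s h).toSet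
  | 0, _ => ⟨[], Nat.zero_le _, rfl, hx⟩
  | j + 1, hj => by
    obtain ⟨s, h, hs, hxs⟩ := exists_mem_rect hx j (Nat.le_of_succ_le hj)
    obtain ⟨b, hb⟩ := Rect.exists_mem_child (rect_nondegenerate T s h)
      (T ⟨s, by omega⟩) hxs
    exact ⟨b :: s, by simp; omega, by simp [hs], hb⟩

theorem refMeasure_rect_pos (s : List Side) (h : s.length ≤ K) :
    0 < refMeasure d (rect T s h).toSet := by
  rw [refMeasure, Measure.restrict_apply (Rect.measurableSet_toSet _),
    Set.inter_eq_left.2 (rect_subset_unitRect T s h), Rect.toSet, Real.volume_pi_Ioc]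
  exact CanonicallyOrderedAdd.prod_pos.2 fun i _ =>
    ENNReal.ofReal_pos.2 (sub_pos.2 (rect_nondegenerate T s h i))

instance isProbabilityMeasure_refMeasure : IsProbabilityMeasure (refMeasure d) := by
  constructor
  rw [refMeasure, Measure.restrict_apply_univ, Rect.toSet, Real.volume_pi_Ioc]
  simp [unitRect]

theorem childRect_disjoint (A : Inner K) :
    Disjoint (childRect T A .left).toSet (childRect T A .right).toSet :=
  Set.disjoint_left.2 fun _ hl hr => by
    cases Rect.eq_of_mem_child (rect_nondegenerate T A.1 (Nat.le_of_lt A.2)) (T A)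
      (b := .left) (b' := .right) hl hr

theorem nodeRect_eq_union (A : Inner K) : (nodeRect T A).toSet =
    (childRect T A .left).toSet ∪ (childRect T A .right).toSet := by
  ext x
  constructor
  · intro hx
    obtain ⟨b, hb⟩ := Rect.exists_mem_child (rect_nondegenerate T A.1 _) (T A) hx
    cases b
    · exact Or.inl hb
    · exact Or.inr hb
  · rintro (hx | hx) <;> exact rect_cons_subset T _ A.1 A.2 hx

/-! ### Factorization of the likelihood over the nodes -/

open Classical in
/-- The factor which a single observation contributes at a node. -/
def turnWeight (t : ℝ) (A : Inner K) (x : Fin d → ℝ) : ℝ :=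
  (if x ∈ (childRect T A .left).toSet then t else 1) *
    (if x ∈ (childRect T A .right).toSet then 1 - t else 1)

theorem turnWeight_left {t : ℝ} {A : Inner K} {x : Fin d → ℝ}
    (hx : x ∈ (childRect T A .left).toSet) : turnWeight T t A x = t := by
  simp [turnWeight, hx, Set.disjoint_left.1 (childRect_disjoint T A) hx]

theorem turnWeight_right {t : ℝ} {A : Inner K} {x : Fin d → ℝ}
    (hx : x ∈ (childRect T A .right).toSet) : turnWeight T t A x = 1 - t := by
  simp [turnWeight, hx, Set.disjoint_right.1 (childRect_disjoint T A) hx]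

theorem turnWeight_of_notMem {t : ℝ} {A : Inner K} {x : Fin d → ℝ}
    (hx : x ∉ (nodeRect T A).toSet) : turnWeight T t A x = 1 := by
  rw [nodeRect_eq_union, Set.mem_union, not_or] at hx
  simp [turnWeight, hx.1, hx.2]

/-- At each level only the ancestor of `s` contains `x`; all other nodes there have weight one. The
product along the path may therefore be taken over all nodes above the level of `s`. -/
theorem mass_eq_prod (θ : Inner K → ℝ) {x : Fin d → ℝ} : ∀ (s : List Side) (h : s.length ≤ K),
    x ∈ (rect T s h).toSet →
    mass θ s h = ∏ A : Inner K, if A.1.length < s.length then turnWeight T (θ A) A x else 1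
  | [], _, _ => by simp [mass]
  | b :: s, h, hx => by
    have hs := rect_cons_subset T b s h hx
    have e : ∀ A : Inner K, (if A.1.length < (b :: s).length then turnWeight T (θ A) A x else 1) =
        (if A.1.length < s.length then turnWeight T (θ A) A x else 1) *
          (if A = ⟨s, h⟩ then turnWeight T (θ A) A x else 1) := by
      intro A
      rcases eq_or_ne A ⟨s, h⟩ with rfl | hA
      · simp
      · rcases lt_trichotomy A.1.length s.length with hl | hl | hl
        · simp [hl, hA, hl.trans (Nat.lt_succ_self _)]
        · have : x ∉ (nodeRect T A).toSet := fun hxA => hA (Subtype.ext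
            (eq_of_mem_rect T (Nat.le_of_lt A.2) (Nat.le_of_succ_le h) hl hxA hs))
          simp [hA, hl, turnWeight_of_notMem T this]
        · have h1 : ¬ A.1.length < s.length := by omega
          have h2 : ¬ A.1.length < (b :: s).length := by simp; omega
          rw [if_neg h1, if_neg h2, if_neg hA, one_mul]
    rw [Finset.prod_congr rfl fun A _ => e A, Finset.prod_mul_distrib, Finset.prod_ite_eq',
      ← mass_eq_prod θ s (Nat.le_of_succ_le h) hs]
    cases b
    · simp [mass, turnWeight_left T (A := ⟨s, h⟩) hx]
    · simp [mass, turnWeight_right T (A := ⟨s, h⟩) hx]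

/-- The part of the density which does not depend on the conditional probabilities. -/
def baseDensity (x : Fin d → ℝ) : ℝ :=
  ∑ A : Leaf K, (leafRect T A).toSet.indicator
    (fun _ => 1 / (refMeasure d).real (leafRect T A).toSet) x

/-- Written over all non-leaf nodes, the mass of the leaf containing `x` no longer mentions the
leaf, so it comes out of the sum. -/
theorem density_eq (θ : Inner K → ℝ) (x : Fin d → ℝ) :
    density T θ x = baseDensity T x * ∏ A : Inner K, turnWeight T (θ A) A x := by
  rw [density, baseDensity, Finset.sum_mul]
  refine Finset.sum_congr rfl fun L _ => ?_
  by_cases hx : x ∈ (leafRect T L).toSet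
  · rw [Set.indicator_of_mem hx, Set.indicator_of_mem hx,
      mass_eq_prod T θ L.1 (Nat.le_of_eq L.2) hx, one_div, mul_comm, div_eq_mul_inv]
    congr 1
    exact Finset.prod_congr rfl fun A _ => if_pos (A.2.trans_eq L.2.symm)
  · rw [Set.indicator_of_notMem hx, Set.indicator_of_notMem hx, zero_mul]

theorem baseDensity_pos {x : Fin d → ℝ} (hx : x ∈ (unitRect d).toSet) : 0 < baseDensity T x := by
  obtain ⟨s, h, hs, hxs⟩ := exists_mem_rect T hx K le_rfl
  have hpos : ∀ L : Leaf K, 0 < (refMeasure d).real (leafRect T L).toSet := fun L =>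
    ENNReal.toReal_pos (refMeasure_rect_pos T L.1 _).ne' (measure_ne_top _ _)
  refine Finset.sum_pos' (fun L _ => Set.indicator_nonneg (fun _ _ => (one_div_pos.2 (hpos L)).le) _)
    ⟨⟨s, hs⟩, Finset.mem_univ _, ?_⟩
  rw [Set.indicator_of_mem (show x ∈ (leafRect T ⟨s, hs⟩).toSet from hxs)]
  exact one_div_pos.2 (hpos _)

open Classical in
/-- The number of observations of group `g` in a child of a node. -/
def childCount {m : Fin 2 → ℕ} (x : Sample d m) (A : Inner K) (b : Side) (g : Fin 2) : ℕ :=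
  (Finset.univ.filter fun i => x g i ∈ (childRect T A b).toSet).card

theorem likelihood_eq {m : Fin 2 → ℕ} (x : Sample d m) (θ : Inner K → Fin 2 → ℝ) :
    MRS.likelihood T x θ = (∏ g, ∏ i, baseDensity T (x g i)) *
      ∏ A : Inner K, ∏ g, θ A g ^ childCount T x A .left g *
        (1 - θ A g) ^ childCount T x A .right g := by
  have h (g : Fin 2) (A : Inner K) : ∏ i, turnWeight T (θ A g) A (x g i) =
      θ A g ^ childCount T x A .left g * (1 - θ A g) ^ childCount T x A .right g := by
    simp only [turnWeight, Finset.prod_mul_distrib, ← Finset.prod_filter, Finset.prod_const,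
      childCount]
  simp only [MRS.likelihood, density_eq, ← h]
  rw [Finset.prod_comm, ← Finset.prod_mul_distrib]
  refine Finset.prod_congr rfl fun g _ => ?_
  rw [Finset.prod_mul_distrib, Finset.prod_comm]

/-! ### Marginal likelihoods -/

theorem integral_betaPDFReal {a b : ℝ} (ha : 0 < a) (hb : 0 < b) :
    ∫ t, betaPDFReal a b t = 1 := by
  have h0 : ∀ t, 0 ≤ betaPDFReal a b t := fun t => by
    by_cases h : 0 < t ∧ t < 1
    · exact (betaPDFReal_pos h.1 h.2 ha hb).le
    · rw [betaPDFReal, if_neg h]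
  rw [integral_eq_lintegral_of_nonneg_ae (ae_of_all _ h0)
    (measurable_betaPDFReal a b).aestronglyMeasurable]
  change (∫⁻ t, betaPDF a b t).toReal = 1
  rw [lintegral_betaPDF_eq_one ha hb, ENNReal.toReal_one]

/-- Conjugacy: the integrand times the prior density is `betaRatio` times the `Beta(a + k, b + l)`
density. -/
theorem integral_betaMeasure {a b : ℝ} (ha : 0 < a) (hb : 0 < b) (k l : ℕ) :
    ∫ t, t ^ k * (1 - t) ^ l ∂(betaMeasure a b) = betaRatio a b k l := by
  have hm : Measurable (betaPDF a b) := (measurable_betaPDFReal a b).ennreal_ofReal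
  rw [betaMeasure, integral_withDensity_eq_integral_toReal_smul hm
    (ae_of_all _ fun t => ENNReal.ofReal_lt_top)]
  have hk : 0 < a + k := by positivity
  have hl : 0 < b + l := by positivity
  have hI := integral_const_mul (μ := volume) (betaRatio a b k l) (betaPDFReal (a + k) (b + l))
  rw [integral_betaPDFReal hk hl, mul_one] at hI
  rw [← hI]
  refine integral_congr_ae (ae_of_all _ fun t => ?_)
  have e1 := (beta_pos ha hb).ne'
  have e2 := (beta_pos hk hl).ne'
  by_cases h : 0 < t ∧ t < 1
  · have h1 : 0 < 1 - t := by linarith [h.2]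
    simp only [betaPDF, smul_eq_mul]
    rw [ENNReal.toReal_ofReal (betaPDFReal_pos h.1 h.2 ha hb).le, betaPDFReal, if_pos h,
      betaPDFReal, if_pos h, betaRatio, show a + k - 1 = a - 1 + k by ring,
      show b + l - 1 = b - 1 + l by ring, Real.rpow_add_natCast h.1.ne',
      Real.rpow_add_natCast h1.ne']
    field_simp
  · simp [betaPDF, betaPDFReal, if_neg h]

namespace MRS

variable {T} (M : MRS d NL K)

/-- The marginal likelihood of the turns at a node given its state. -/
def nodeMarginal (T : Tree d NL K) (A : Inner K) (k l : Fin 2 → ℕ) : State → ℝ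
  | .one => ∏ g, betaRatio (M.sepPar T A g .left) (M.sepPar T A g .right) (k g) (l g)
  | _ => betaRatio (M.comPar T A .left) (M.comPar T A .right) (∑ g, k g) (∑ g, l g)

theorem nodeMarginal_pos (T : Tree d NL K) (A : Inner K) (k l : Fin 2 → ℕ) (v : State) :
    0 < M.nodeMarginal T A k l v := by
  cases v
  · exact Finset.prod_pos fun g _ => betaRatio_pos (M.sepPar_pos T A g _) (M.sepPar_pos T A g _) _ _
  all_goals exact betaRatio_pos (M.comPar_pos T A _) (M.comPar_pos T A _) _ _

theorem isProbabilityMeasure_nodePrior (T : Tree d NL K) (A : Inner K) (v : State) :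
    IsProbabilityMeasure (M.nodePrior T A v) := by
  have := fun g => isProbabilityMeasureBeta (M.sepPar_pos T A g .left) (M.sepPar_pos T A g .right)
  have := isProbabilityMeasureBeta (M.comPar_pos T A .left) (M.comPar_pos T A .right)
  have hm : Measurable fun (t : ℝ) (_ : Fin 2) => t := by fun_prop
  cases v
  · exact Measure.pi.instIsProbabilityMeasure _
  all_goals exact Measure.isProbabilityMeasure_map hm.aemeasurable

theorem integral_nodePrior (T : Tree d NL K) (A : Inner K) (k l : Fin 2 → ℕ) (v : State) :
    ∫ θ, ∏ g, θ g ^ k g * (1 - θ g) ^ l g ∂(M.nodePrior T A v) = M.nodeMarginal T A k l v := by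
  have hm : Measurable fun (t : ℝ) (_ : Fin 2) => t := by fun_prop
  have hc : ∫ θ, ∏ g, θ g ^ k g * (1 - θ g) ^ l g
      ∂((betaMeasure (M.comPar T A .left) (M.comPar T A .right)).map fun t _ => t) =
      betaRatio (M.comPar T A .left) (M.comPar T A .right) (∑ g, k g) (∑ g, l g) := by
    rw [integral_map hm.aemeasurable (by fun_prop),
      ← integral_betaMeasure (M.comPar_pos T A _) (M.comPar_pos T A _)]
    simp only [Finset.prod_mul_distrib, Finset.prod_pow_eq_pow_sum]
  cases v
  · have := fun g =>
      isProbabilityMeasureBeta (M.sepPar_pos T A g .left) (M.sepPar_pos T A g .right)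
    simp only [nodePrior, nodeMarginal]
    rw [integral_fintype_prod_eq_prod (fun g (t : ℝ) => t ^ k g * (1 - t) ^ l g)]
    exact Finset.prod_congr rfl fun g _ =>
      integral_betaMeasure (M.sepPar_pos T A g _) (M.sepPar_pos T A g _) _ _
  all_goals exact hc

theorem marginalLikelihood_eq {m : Fin 2 → ℕ} (x : Sample d m) (v : Inner K → State) :
    M.marginalLikelihood x T v = (∏ g, ∏ i, baseDensity T (x g i)) *
      ∏ A, M.nodeMarginal T A (childCount T x A .left) (childCount T x A .right) (v A) := by
  have := fun A => M.isProbabilityMeasure_nodePrior T A (v A)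
  simp only [marginalLikelihood, likelihood_eq, thetaPrior]
  rw [integral_const_mul, integral_fintype_prod_eq_prod (fun A (t : Fin 2 → ℝ) =>
    ∏ g, t g ^ childCount T x A .left g * (1 - t g) ^ childCount T x A .right g)]
  simp only [integral_nodePrior]

end MRS

end

section

/-! ### Concentration of the counts -/

/-- Convergence along this filter is uniform convergence on the events `G C n`. Choosing `C` first,
depending on the tolerated probability, makes the exceptional events small for all large `n`. Only
monotonicity of `ν` is used, so `f` need not be measurable. -/
theorem tendstoInMeasure_of_tendsto_on_events {S : Type*} [MeasurableSpace S] {ν : Measure S}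
    {f : ℕ → S → ℝ} {c : ℝ} {G : ℝ → ℕ → Set S} {D : ℝ}
    (hG : ∀ C > 0, ∀ᶠ n in atTop, ν (G C n)ᶜ ≤ ENNReal.ofReal (D / C ^ 2))
    (h : ∀ C > 0, Tendsto (fun p : ℕ × S => f p.1 p.2)
      (comap Prod.fst atTop ⊓ 𝓟 {p | p.2 ∈ G C p.1}) (𝓝 c)) :
    TendstoInMeasure ν f atTop fun _ => c := by
  rw [tendstoInMeasure_iff_dist]
  intro ε hε
  rw [ENNReal.tendsto_nhds_zero]
  intro δ hδ
  have hD : Tendsto (fun C : ℝ => ENNReal.ofReal (D / C ^ 2)) atTop (𝓝 0) := by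
    rw [← ENNReal.ofReal_zero]
    exact ENNReal.tendsto_ofReal ((tendsto_pow_atTop two_ne_zero).const_div_atTop D)
  obtain ⟨C, hC0, hC⟩ := ((eventually_gt_atTop 0).and (ENNReal.tendsto_nhds_zero.1 hD δ hδ)).exists
  have hev := (h C hC0).eventually (Metric.ball_mem_nhds c hε)
  rw [eventually_inf_principal, eventually_comap] at hev
  filter_upwards [hev, hG C hC0] with n hn hGn
  refine (measure_mono fun ω hω => ?_).trans (hGn.trans hC)
  intro hωG
  exact (not_lt.2 hω) (hn (n, ω) rfl hωG)

/-- Chebyshev's inequality for a sum of `N ≤ n` pairwise independent indicators, each of variance at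
most one. -/
theorem measure_count_sub_ge_le {S E : Type*} [MeasurableSpace S] [MeasurableSpace E]
    {ν : Measure S} [IsProbabilityMeasure ν] {Q : Measure E} {Y : ℕ → S → E}
    (hY : ∀ i, HasLaw (Y i) Q ν) (hind : Pairwise fun i j => Y i ⟂ᵢ[ν] Y j)
    {B : Set E} (hB : MeasurableSet B) [DecidablePred (· ∈ B)] {N n : ℕ} (hN : N ≤ n) (hn : 0 < n)
    {C : ℝ} (hC : 0 < C) :
    ν {ω | C * √n ≤ |((Finset.univ.filter fun i : Fin N => Y i ω ∈ B).card : ℝ) - N * Q.real B|} ≤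
      ENNReal.ofReal (1 / C ^ 2) := by
  have hφ : Measurable (B.indicator fun _ => (1 : ℝ)) := measurable_const.indicator hB
  set Z : Fin N → S → ℝ := fun i ω => B.indicator (fun _ => (1 : ℝ)) (Y i ω) with hZ
  have hZm : ∀ i, AEMeasurable (Z i) ν := fun i => hφ.comp_aemeasurable (hY i).aemeasurable
  have hZb : ∀ i ω, Z i ω ∈ Set.Icc (0 : ℝ) 1 := fun i ω => by
    by_cases h : Y i ω ∈ B <;> simp [hZ, h]
  have hL : ∀ i, MemLp (Z i) 2 ν := fun i =>
    memLp_of_bounded (ae_of_all _ (hZb i)) (hZm i).aestronglyMeasurable 2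
  have hE : ∀ i, ∫ ω, Z i ω ∂ν = Q.real B := fun i => by
    rw [← integral_indicator_one hB, ← (hY i).map_eq,
      integral_map (hY i).aemeasurable (by exact hφ.aestronglyMeasurable)]
    rfl
  have hsum : ∀ ω, (∑ i, Z i) ω = ((Finset.univ.filter fun i : Fin N => Y i ω ∈ B).card : ℝ) := by
    intro ω
    simp [hZ, Finset.sum_apply, Set.indicator_apply, Finset.sum_boole]
  have hES : ∫ ω, (∑ i, Z i) ω ∂ν = N * Q.real B := by
    simp only [Finset.sum_apply]
    rw [integral_finsetSum _ fun i _ => (hL i).integrable (by norm_num)]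
    simp [hE]
  have hvar : variance (∑ i, Z i) ν ≤ n := by
    rw [IndepFun.variance_sum (fun i _ => hL i) fun i _ j _ hij =>
      (hind (fun h => hij (Fin.ext h))).comp hφ hφ]
    calc ∑ i, variance (Z i) ν ≤ ∑ _i : Fin N, (1 : ℝ) := Finset.sum_le_sum fun i _ =>
          (variance_le_sq_of_bounded (ae_of_all _ (hZb i)) (hZm i)).trans (by norm_num)
      _ = N := by simp
      _ ≤ n := by exact_mod_cast hN
  have hn' : (0 : ℝ) < n := by exact_mod_cast hn
  have := meas_ge_le_variance_div_sq (μ := ν) (X := ∑ i, Z i)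
    (memLp_finsetSum' _ fun i _ => hL i) (c := C * √n) (by positivity)
  rw [hES] at this
  simp only [hsum] at this
  refine this.trans (ENNReal.ofReal_le_ofReal ?_)
  rw [mul_pow, Real.sq_sqrt hn'.le]
  calc variance (∑ i, Z i) ν / (C ^ 2 * n) ≤ n / (C ^ 2 * n) := by gcongr
    _ = 1 / C ^ 2 := by field_simp

variable {d NL K : ℕ} {P : Fin 2 → Measure (Fin d → ℝ)}

/-- The event that all observations are in the sample space and that the counts in all possible
nodes deviate from their means by less than `C √n`. -/
def typicalEvent (d NL K : ℕ) (P : Fin 2 → Measure (Fin d → ℝ)) {S : Type*}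
    (X : Fin 2 → ℕ → S → Fin d → ℝ) (size : ℕ → Fin 2 → ℕ) (C : ℝ) (n : ℕ) : Set S :=
  {ω | (∀ g i, X g i ω ∈ (unitRect d).toSet) ∧ ∀ (T : Tree d NL K) A b g,
    |(childCount T (m := size n) (fun g i => X g i ω) A b g : ℝ) -
      size n g * (P g).real (childRect T A b).toSet| < C * √n}

/-- Union bound over trees, nodes, sides and groups, whose number does not depend on `n`; leaving
the sample space has probability zero because `P g ≪ refMeasure d`. -/
theorem measure_compl_typicalEvent_le {S : Type*} [MeasurableSpace S] {ν : Measure S}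
    [IsProbabilityMeasure ν] (hP : ∀ g, P g ≪ refMeasure d)
    {X : Fin 2 → ℕ → S → Fin d → ℝ} (hlaw : ∀ g i, HasLaw (X g i) (P g) ν)
    (hindep : iIndepFun (fun p : Fin 2 × ℕ => X p.1 p.2) ν)
    {size : ℕ → Fin 2 → ℕ} (hsize : ∀ n, ∑ g, size n g = n) {C : ℝ} (hC : 0 < C) {n : ℕ}
    (hn : 0 < n) :
    ν (typicalEvent d NL K P X size C n)ᶜ ≤
      ENNReal.ofReal (Nat.card (Tree d NL K × Inner K × Side × Fin 2) / C ^ 2) := by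
  classical
  have hΩ : ν {ω | ∀ g i, X g i ω ∈ (unitRect d).toSet}ᶜ = 0 := by
    change ∀ᵐ ω ∂ν, ∀ g i, X g i ω ∈ (unitRect d).toSet
    rw [ae_all_iff]
    intro g
    rw [ae_all_iff]
    intro i
    have : ∀ᵐ x ∂(P g), x ∈ (unitRect d).toSet :=
      (hP g).ae_le (ae_restrict_mem (Rect.measurableSet_toSet _))
    rw [← (hlaw g i).map_eq] at this
    exact ae_of_ae_map (hlaw g i).aemeasurable this
  have hsub : (typicalEvent d NL K P X size C n)ᶜ ⊆
      {ω | ∀ g i, X g i ω ∈ (unitRect d).toSet}ᶜ ∪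
      ⋃ q : Tree d NL K × Inner K × Side × Fin 2, {ω | C * √n ≤
        |(childCount q.1 (m := size n) (fun g i => X g i ω) q.2.1 q.2.2.1 q.2.2.2 : ℝ) -
          size n q.2.2.2 * (P q.2.2.2).real (childRect q.1 q.2.1 q.2.2.1).toSet|} := by
    intro ω hω
    by_cases h : ∀ g i, X g i ω ∈ (unitRect d).toSet
    · right
      by_contra hcon
      simp only [Set.mem_iUnion, Set.mem_ofPred_eq, not_exists, not_le] at hcon
      exact hω ⟨h, fun T A b g => hcon (T, A, b, g)⟩
    · exact Or.inl h
  refine (measure_mono hsub).trans ((measure_union_le _ _).trans ?_)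
  rw [hΩ, zero_add]
  refine (measure_iUnion_fintype_le _ _).trans ?_
  refine (Finset.sum_le_sum (g := fun _ => ENNReal.ofReal (1 / C ^ 2)) fun q _ => ?_).trans ?_
  · refine measure_count_sub_ge_le (hlaw q.2.2.2) (fun i j hij => ?_)
      (Rect.measurableSet_toSet _) ?_ hn hC
    · exact hindep.indepFun (i := (q.2.2.2, i)) (j := (q.2.2.2, j)) (by simp [hij])
    · exact (Finset.single_le_sum (f := size n) (fun _ _ => Nat.zero_le _)
        (Finset.mem_univ q.2.2.2)).trans_eq (hsize n)
  · rw [Finset.sum_const, nsmul_eq_mul, Finset.card_univ, Nat.card_eq_fintype_card,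
      ← ENNReal.ofReal_natCast, ← ENNReal.ofReal_mul (by positivity), mul_one_div]

/-- An almost everywhere positive density gives `refMeasure d ≪ P g`, and every rectangle of the
tree has positive volume. -/
theorem measureReal_rect_pos [∀ g, IsProbabilityMeasure (P g)] (hP : ∀ g, P g ≪ refMeasure d)
    (hpos : ∀ g, ∀ᵐ y ∂(refMeasure d), 0 < (P g).rnDeriv (refMeasure d) y) (T : Tree d NL K)
    (g : Fin 2) (s : List Side) (h : s.length ≤ K) : 0 < (P g).real (rect T s h).toSet := by
  have hac : refMeasure d ≪ P g := by
    have := withDensity_absolutelyContinuous' (μ := refMeasure d)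
      ((P g).measurable_rnDeriv (refMeasure d)).aemeasurable ((hpos g).mono fun y hy => hy.ne')
    have hd : (P g).HaveLebesgueDecomposition (refMeasure d) :=
      Measure.haveLebesgueDecomposition_of_sigmaFinite _ _
    rwa [Measure.withDensity_rnDeriv_eq _ _ (hP g)] at this
  exact ENNReal.toReal_pos (fun h0 => (refMeasure_rect_pos T s h).ne' (hac h0)) (measure_ne_top _ _)

theorem trueDifference_eq_one_iff [∀ g, IsProbabilityMeasure (P g)] (T : Tree d NL K) (A : Inner K) :
    trueDifference P T A = 1 ↔
      (P 0).real (childRect T A .left).toSet / ((P 0).real (childRect T A .left).toSet +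
        (P 0).real (childRect T A .right).toSet) ≠
      (P 1).real (childRect T A .left).toSet / ((P 1).real (childRect T A .left).toSet +
        (P 1).real (childRect T A .right).toSet) := by
  have h (g : Fin 2) : ((P g)[|(nodeRect T A).toSet]).real (childRect T A .left).toSet =
      (P g).real (childRect T A .left).toSet / ((P g).real (childRect T A .left).toSet +
        (P g).real (childRect T A .right).toSet) := by
    rw [measureReal_def, cond_apply (Rect.measurableSet_toSet _), ENNReal.toReal_mul,
      ENNReal.toReal_inv, ← measureReal_def, ← measureReal_def, Set.inter_eq_right.2
      (by rw [nodeRect_eq_union]; exact Set.subset_union_left), nodeRect_eq_union,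
      measureReal_union (childRect_disjoint T A) (Rect.measurableSet_toSet _), div_eq_inv_mul]
  rw [← h, ← h, measureReal_def, measureReal_def, ne_eq,
    ENNReal.toReal_eq_toReal_iff' (measure_ne_top _ _) (measure_ne_top _ _), trueDifference]
  split_ifs with hc <;> simp [hc]

end

section

/-! ### Consistency of the posterior along typical samples -/

namespace MRS

variable {d NL K : ℕ} (M : MRS d NL K)

/-- A state with a given difference indicator. -/
def refState (z : Fin 2) : State := if z = 1 then .one else .two

theorem stateFactor_nonneg (T : Tree d NL K) (v : Inner K → State) :
    ∀ A, 0 ≤ M.stateFactor T v A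
  | ⟨[], _⟩ => M.init_nonneg _ _
  | ⟨_ :: _, _⟩ => M.trans_nonneg _ _ _ _

theorem statePrior_nonneg (T : Tree d NL K) (v : Inner K → State) : 0 ≤ M.statePrior T v :=
  Finset.prod_nonneg fun A _ => M.stateFactor_nonneg T v A

theorem marginalLikelihood_pos {m : Fin 2 → ℕ} {x : Sample d m}
    (hx : ∀ g i, x g i ∈ (unitRect d).toSet) (T : Tree d NL K) (v : Inner K → State) :
    0 < M.marginalLikelihood x T v := by
  rw [marginalLikelihood_eq]
  exact mul_pos (Finset.prod_pos fun g _ => Finset.prod_pos fun i _ => baseDensity_pos T (hx g i))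
    (Finset.prod_pos fun A _ => M.nodeMarginal_pos _ _ _ _ _)

theorem sum_joint_pos {m : Fin 2 → ℕ} {x : Sample d m}
    (hx : ∀ g i, x g i ∈ (unitRect d).toSet) {T : Tree d NL K} {z : Inner K → Fin 2}
    (hz : 0 < M.indicatorPrior T z) : 0 < ∑ v, M.joint x T v := by
  obtain ⟨v, -, hv⟩ := Finset.exists_ne_zero_of_sum_ne_zero hz.ne'
  refine Finset.sum_pos' (fun v _ => mul_nonneg (M.statePrior_nonneg T v)
    (M.marginalLikelihood_pos hx T v).le) ⟨v, Finset.mem_univ _, mul_pos ?_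
    (M.marginalLikelihood_pos hx T v)⟩
  exact (M.statePrior_nonneg T v).lt_of_ne' fun h => hv (by simp [h])

variable {P : Fin 2 → Measure (Fin d → ℝ)} [∀ g, IsProbabilityMeasure (P g)]
  {ι : Type*} {F : Filter ι} {n : ι → ℝ} {m : ι → Fin 2 → ℕ} {ζ : Fin 2 → ℝ} {C : ℝ}

theorem nodeRatio_tendsto (hn : Tendsto n F atTop) (hζ : ∀ g, 0 < ζ g)
    (hm : ∀ g, Tendsto (fun i => (m i g : ℝ) / n i) F (𝓝 (ζ g))) {T : Tree d NL K} {A : Inner K}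
    {k : Side → Fin 2 → ι → ℕ}
    (hP : ∀ b g, 0 < (P g).real (childRect T A b).toSet)
    (hk : ∀ b g, ∀ᶠ i in F, |k b g i - m i g * (P g).real (childRect T A b).toSet| ≤ C * √(n i))
    (v : State) :
    Tendsto (fun i => M.nodeMarginal T A (fun g => k .left g i) (fun g => k .right g i) v /
      M.nodeMarginal T A (fun g => k .left g i) (fun g => k .right g i)
        (refState (trueDifference P T A))) F
      (𝓝 (if v.Z = trueDifference P T A then 1 else 0)) := by
  set p : Side → Fin 2 → ℝ := fun b g => (P g).real (childRect T A b).toSet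
  have hfreq : ∀ b g, Tendsto (fun i => k b g i / n i) F (𝓝 (ζ g * p b g)) := by
    intro b g
    have h1 : Tendsto (fun i => C / √(n i)) F (𝓝 0) :=
      (Real.tendsto_sqrt_atTop.comp hn).const_div_atTop C
    have h2 : Tendsto (fun i => k b g i / n i - m i g / n i * p b g) F (𝓝 0) := by
      refine squeeze_zero_norm' ?_ h1
      filter_upwards [hk b g, hn.eventually_gt_atTop 0] with i hi hni
      rw [div_mul_eq_mul_div, ← sub_div, Real.norm_eq_abs, abs_div, abs_of_pos hni,
        div_le_div_iff₀ hni (Real.sqrt_pos.2 hni)]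
      calc _ ≤ C * √(n i) * √(n i) := by gcongr
        _ = C * n i := by rw [mul_assoc, Real.mul_self_sqrt hni.le]
    simpa using h2.add ((hm g).mul_const (p b g))
  have hpos : ∀ b g, 0 < ζ g * p b g := fun b g => mul_pos (hζ g) (hP b g)
  -- The sampling proportions cancel, so limiting count fractions are the true conditional
  -- probabilities.
  have hfrac : ∀ g, ζ g * p .left g / (ζ g * p .left g + ζ g * p .right g) =
      p .left g / (p .left g + p .right g) := fun g => by
    rw [← mul_add, mul_div_mul_left _ _ (hζ g).ne']
  have hiff := trueDifference_eq_one_iff (P := P) T A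
  rcases eq_or_ne (trueDifference P T A) 1 with hz | hz
  · have hne := hiff.1 hz
    have hmain := bayesFactor_inv_tendsto_zero hn (k := k .left) (l := k .right) (hpos .left)
      (hpos .right) (hfreq .left) (hfreq .right)
      (fun g => M.sepPar_pos T A g .left) (fun g => M.sepPar_pos T A g .right)
      (M.comPar_pos T A .left) (M.comPar_pos T A .right) (by rwa [hfrac, hfrac])
    rw [hz]
    cases v
    · rw [if_pos (by rfl)]
      refine tendsto_const_nhds.congr fun i => ?_
      exact (div_self (M.nodeMarginal_pos _ _ _ _ _).ne').symm
    all_goals exact hmain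
  · have heq := not_not.1 (mt hiff.2 hz)
    have hz0 : trueDifference P T A = 0 := by omega
    have hpp : ∀ g, 0 < p .left g + p .right g := fun g => add_pos (hP _ g) (hP _ g)
    set t := p .left 0 / (p .left 0 + p .right 0) with ht
    have ht0 : 0 < t := div_pos (hP _ _) (hpp 0)
    have ht1 : t < 1 := by rw [ht, div_lt_one (hpp 0)]; exact lt_add_of_pos_right _ (hP _ _)
    have htg : ∀ g, (1 - t) * p .left g = t * p .right g := by
      intro g
      have : t = p .left g / (p .left g + p .right g) := by
        fin_cases g
        · rfl
        · exact heq
      have := (eq_div_iff (hpp g).ne').1 this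
      linarith
    have hmain := bayesFactor_tendsto_zero hn (k := k .left) (l := k .right) (hpos .left)
      (hpos .right) (hfreq .left) (hfreq .right)
      (fun g => M.sepPar_pos T A g .left) (fun g => M.sepPar_pos T A g .right)
      (M.comPar_pos T A .left) (M.comPar_pos T A .right) ht0 ht1 (C := C) (fun g => by
        filter_upwards [hk .left g, hk .right g] with i h1 h2
        -- The means cancel by `htg`, and the deviations enter with weights `1 - t` and `t` of sum
        -- one, so the same `C` serves.
        have e : (1 - t) * (k .left g i : ℝ) - t * k .right g i =
            (1 - t) * (k .left g i - m i g * p .left g) -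
              t * (k .right g i - m i g * p .right g) := by
          linear_combination (m i g : ℝ) * htg g
        rw [e]
        refine (abs_sub _ _).trans ?_
        rw [abs_mul, abs_mul, abs_of_pos ht0, abs_of_pos (sub_pos.2 ht1)]
        have e1 := mul_le_mul_of_nonneg_left h1 (sub_pos.2 ht1).le
        have e2 := mul_le_mul_of_nonneg_left h2 ht0.le
        linarith)
    rw [hz0]
    cases v
    · exact hmain
    -- States `two` and `three` have the same marginal likelihood, so their ratio to the reference
    -- state `two` is exactly one.
    all_goals
      rw [if_pos (by rfl)]
      refine tendsto_const_nhds.congr fun i => ?_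
      exact (div_self (M.nodeMarginal_pos T A _ _ .two).ne').symm

theorem posteriorGivenTree_tendsto_one (hn : Tendsto n F atTop) (hζ : ∀ g, 0 < ζ g)
    (hm : ∀ g, Tendsto (fun i => (m i g : ℝ) / n i) F (𝓝 (ζ g))) {T : Tree d NL K}
    {x : ∀ i, Sample d (m i)} (hx : ∀ᶠ i in F, ∀ g j, x i g j ∈ (unitRect d).toSet)
    (hP : ∀ A b g, 0 < (P g).real (childRect T A b).toSet)
    (hk : ∀ A b g, ∀ᶠ i in F, |childCount T (x i) A b g -
      m i g * (P g).real (childRect T A b).toSet| ≤ C * √(n i))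
    (hprior : 0 < M.indicatorPrior T (trueDifference P T)) :
    Tendsto (fun i => M.posteriorGivenTree (x i) T (correctStates P T)) F (𝓝 1) := by
  classical
  set nm : ι → Inner K → State → ℝ := fun i A =>
    M.nodeMarginal T A (childCount T (x i) A .left) (childCount T (x i) A .right)
  -- The reference configuration serves only to normalize; its own prior probability may be zero.
  set R : ι → (Inner K → State) → ℝ := fun i v =>
    ∏ A, nm i A (v A) / nm i A (refState (trueDifference P T A)) with hR
  have hRlim : ∀ v, Tendsto (fun i => R i v) F
      (𝓝 (if v ∈ correctStates P T then 1 else 0)) := by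
    intro v
    have := tendsto_finsetProd (Finset.univ : Finset (Inner K)) fun A _ =>
      M.nodeRatio_tendsto hn hζ hm (k := fun b g i => childCount T (x i) A b g) (hP A) (hk A) (v A)
    have e : (∏ A, if (v A).Z = trueDifference P T A then (1 : ℝ) else 0) =
        if v ∈ correctStates P T then 1 else 0 := by
      simp [Finset.prod_ite_zero, correctStates]
    rwa [e] at this
  have hnum : Tendsto (fun i => ∑ v, (correctStates P T).indicator
      (fun v => M.statePrior T v * R i v) v) F (𝓝 (M.indicatorPrior T (trueDifference P T))) := by
    refine tendsto_finsetSum _ fun v _ => ?_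
    by_cases hv : v ∈ correctStates P T
    · simp only [Set.indicator_of_mem hv, Set.indicator_of_mem (show v ∈
        {v : Inner K → State | ∀ A, (v A).Z = trueDifference P T A} from hv)]
      simpa [hv] using (hRlim v).const_mul (M.statePrior T v)
    · simp only [Set.indicator_of_notMem hv, Set.indicator_of_notMem (show v ∉
        {v : Inner K → State | ∀ A, (v A).Z = trueDifference P T A} from hv), tendsto_const_nhds]
  have hden : Tendsto (fun i => ∑ v, M.statePrior T v * R i v) F
      (𝓝 (M.indicatorPrior T (trueDifference P T))) := by
    refine tendsto_finsetSum _ fun v _ => ?_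
    convert (hRlim v).const_mul (M.statePrior T v) using 2
    by_cases hv : v ∈ correctStates P T
    · rw [if_pos hv, mul_one, Set.indicator_of_mem (show v ∈
        {v : Inner K → State | ∀ A, (v A).Z = trueDifference P T A} from hv)]
    · rw [if_neg hv, mul_zero, Set.indicator_of_notMem (show v ∉
        {v : Inner K → State | ∀ A, (v A).Z = trueDifference P T A} from hv)]
  have hquot := hnum.div hden hprior.ne'
  rw [div_self hprior.ne'] at hquot
  refine hquot.congr' ?_
  filter_upwards [hx] with i hxi
  -- This common factor of all joint probabilities cancels in the posterior; its positivity needs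
  -- the observations to lie in the sample space.
  set D := (∏ g, ∏ j, baseDensity T (x i g j)) *
    ∏ A, nm i A (refState (trueDifference P T A)) with hD
  have hDpos : 0 < D := mul_pos
    (Finset.prod_pos fun g _ => Finset.prod_pos fun j _ => baseDensity_pos T (hxi g j))
    (Finset.prod_pos fun A _ => M.nodeMarginal_pos _ _ _ _ _)
  have hjoint : M.joint (x i) T = fun v => D * (M.statePrior T v * R i v) := by
    funext v
    have hmul : (∏ A, nm i A (refState (trueDifference P T A))) * R i v = ∏ A, nm i A (v A) := by
      rw [hR, ← Finset.prod_mul_distrib]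
      exact Finset.prod_congr rfl fun A _ =>
        mul_div_cancel₀ _ (M.nodeMarginal_pos _ _ _ _ _).ne'
    rw [joint, marginalLikelihood_eq, ← hmul, hD]
    ring
  rw [posteriorGivenTree, hjoint, ← Finset.mul_sum]
  have hind : ∀ v, (correctStates P T).indicator (fun v => D * (M.statePrior T v * R i v)) v =
      D * (correctStates P T).indicator (fun v => M.statePrior T v * R i v) v := fun v => by
    by_cases hv : v ∈ correctStates P T <;> simp [hv]
  simp only [hind]
  rw [← Finset.mul_sum, mul_div_mul_left _ _ hDpos.ne']
  rfl

/-! ### Random trees -/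

/-- The rectangles of the tree built by a splitting rule. -/
def ruleRect (J : Inner K → Rect d → Split d NL) : (s : List Side) → s.length ≤ K → Rect d
  | [], _ => unitRect d
  | b :: s, h => (ruleRect J s (Nat.le_of_succ_le h)).child
      (J ⟨s, h⟩ (ruleRect J s (Nat.le_of_succ_le h))) b

/-- The rectangle of a node depends only on the splits at its ancestors, so a tree whose splits
depend on its own rectangles can be built from the root downwards. -/
theorem exists_tree_of_rule (J : Inner K → Rect d → Split d NL) :
    ∃ T : Tree d NL K, ∀ A : Inner K, T A = J A (nodeRect T A) := by
  set T : Tree d NL K := fun A => J A (ruleRect J A.1 (Nat.le_of_lt A.2)) with hT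
  have h : ∀ (s : List Side) (h : s.length ≤ K), rect T s h = ruleRect J s h := by
    intro s
    induction s with
    | nil => exact fun _ => rfl
    | cons b s ih =>
      intro h
      rw [rect, ruleRect, ih]
  exact ⟨T, fun A => by rw [nodeRect, h]⟩

theorem locWeight_pos {m : Fin 2 → ℕ} (x : Sample d m) (A : Rect d) (l : ℕ) :
    0 < M.locWeight x A l := Real.exp_pos _

theorem treePrior_nonneg {m : Fin 2 → ℕ} (x : Sample d m) (T : Tree d NL K) :
    0 ≤ M.treePrior x T :=
  Finset.prod_nonneg fun _ _ => mul_nonneg (M.dimProb_nonneg _ _ _)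
    (div_nonneg (M.locWeight_pos _ _ _).le (Finset.sum_nonneg fun _ _ => (M.locWeight_pos _ _ _).le))

/-- At every node take a dimension of positive probability for the rectangle reached there, and the
location `1 / NL`, which is admissible as `2 ≤ NL`. -/
theorem exists_treePrior_pos (hNL : 2 ≤ NL) {m : Fin 2 → ℕ} (x : Sample d m) :
    ∃ T : Tree d NL K, 0 < M.treePrior x T := by
  have hex : ∀ (A : Inner K) (B : Rect d), ∃ j, 0 < M.dimProb A B j := by
    intro A B
    by_contra! h
    have := Finset.sum_nonpos fun j (_ : j ∈ Finset.univ) => h j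
    linarith [M.dimProb_sum A B]
  choose j hj using hex
  have h1 : 1 ∈ Finset.Ioo 0 NL := Finset.mem_Ioo.2 ⟨one_pos, hNL⟩
  obtain ⟨T, hT⟩ := exists_tree_of_rule (NL := NL) fun A B => (⟨j A B, ⟨1, h1⟩⟩ : Split d NL)
  refine ⟨T, Finset.prod_pos fun A _ => mul_pos ?_ (div_pos (M.locWeight_pos _ _ _)
    (Finset.sum_pos (fun _ _ => M.locWeight_pos _ _ _) ⟨1, h1⟩))⟩
  rw [congrArg Prod.fst (hT A)]
  exact hj _ _

/-- The quotient is the average of `a t / b t` with weights proportional to `w t * b t`; the bound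
does not involve `w`, which here varies with the data. -/
theorem abs_weighted_ratio_sub_one_le {α : Type*} [Fintype α] {w a b : α → ℝ} (hw : ∀ t, 0 ≤ w t)
    (hb : ∀ t, 0 < b t) (hpos : ∃ t, 0 < w t) :
    |(∑ t, w t * a t) / (∑ t, w t * b t) - 1| ≤ ∑ t, |a t / b t - 1| := by
  obtain ⟨t₀, ht₀⟩ := hpos
  have hnn : ∀ t, 0 ≤ w t * b t := fun t => mul_nonneg (hw t) (hb t).le
  have hden : 0 < ∑ t, w t * b t :=
    Finset.sum_pos' (fun t _ => hnn t) ⟨t₀, Finset.mem_univ _, mul_pos ht₀ (hb t₀)⟩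
  rw [div_sub_one hden.ne', abs_div, abs_of_pos hden, div_le_iff₀ hden, ← Finset.sum_sub_distrib,
    Finset.sum_mul]
  refine (Finset.abs_sum_le_sum_abs _ _).trans (Finset.sum_le_sum fun t _ => ?_)
  have e : w t * a t - w t * b t = w t * b t * (a t / b t - 1) := by
    have := (hb t).ne'
    field_simp
  rw [e, abs_mul, abs_of_nonneg (hnn t), mul_comm]
  gcongr
  exact Finset.single_le_sum (f := fun t => w t * b t) (fun t _ => hnn t) (Finset.mem_univ t)

theorem posterior_tendsto_one (hNL : 2 ≤ NL) {x : ∀ i, Sample d (m i)}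
    (hx : ∀ᶠ i in F, ∀ g j, x i g j ∈ (unitRect d).toSet)
    {E : Tree d NL K → Set (Inner K → State)} {z : Tree d NL K → Inner K → Fin 2}
    (hz : ∀ T, 0 < M.indicatorPrior T (z T))
    (h : ∀ T, Tendsto (fun i => M.posteriorGivenTree (x i) T (E T)) F (𝓝 1)) :
    Tendsto (fun i => M.posterior (x i) E) F (𝓝 1) := by
  have hsum : Tendsto (fun i => ∑ T, |M.posteriorGivenTree (x i) T (E T) - 1|) F (𝓝 0) := by
    have := tendsto_finsetSum Finset.univ fun T _ => ((h T).sub_const 1).abs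
    simpa using this
  rw [← tendsto_sub_nhds_zero_iff]
  refine squeeze_zero_norm' ?_ hsum
  filter_upwards [hx] with i hi
  exact abs_weighted_ratio_sub_one_le (M.treePrior_nonneg (x i))
    (fun T => M.sum_joint_pos hi (hz T)) (M.exists_treePrior_pos hNL (x i))

end MRS

end

end PolyaTree

end

/-! ### Posterior consistency for fixed and random trees -/

theorem mainTheorem6 {d NL K : ℕ} (hNL : 2 ≤ NL) (M : PolyaTree.MRS d NL K)
    (P : Fin 2 → Measure (Fin d → ℝ)) [∀ g, IsProbabilityMeasure (P g)]
    (hP : ∀ g, P g ≪ PolyaTree.refMeasure d)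
    (hpos : ∀ g, ∀ᵐ y ∂(PolyaTree.refMeasure d), 0 < (P g).rnDeriv (PolyaTree.refMeasure d) y)
    {S : Type*} [MeasurableSpace S] (ν : Measure S) [IsProbabilityMeasure ν]
    (X : Fin 2 → ℕ → S → Fin d → ℝ)
    (hlaw : ∀ g i, HasLaw (X g i) (P g) ν)
    (hindep : iIndepFun (fun p : Fin 2 × ℕ => X p.1 p.2) ν)
    (size : ℕ → Fin 2 → ℕ) (hsize : ∀ n, ∑ g, size n g = n)
    (ζ : Fin 2 → ℝ) (hζ : ∀ g, ζ g ∈ Set.Ioc (0 : ℝ) 1)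
    (hlim : ∀ g, Tendsto (fun n => (size n g : ℝ) / (n : ℝ)) atTop (𝓝 (ζ g))) :
    (∀ T : PolyaTree.Tree d NL K, (∀ z, 0 < M.indicatorPrior T z) →
      TendstoInMeasure ν
        (fun n ω => M.posteriorGivenTree (m := size n) (fun g i => X g i ω) T
          (PolyaTree.correctStates P T))
        atTop (fun _ => 1)) ∧
    ((∀ T z, 0 < M.indicatorPrior T z) →
      TendstoInMeasure ν
        (fun n ω => M.posterior (m := size n) (fun g i => X g i ω) (PolyaTree.correctStates P))
        atTop (fun _ => 1)) := by
  have hG : ∀ C > 0, ∀ᶠ n in atTop, ν (PolyaTree.typicalEvent d NL K P X size C n)ᶜ ≤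
      ENNReal.ofReal (Nat.card (PolyaTree.Tree d NL K × PolyaTree.Inner K × PolyaTree.Side × Fin 2)
        / C ^ 2) := fun C hC => by
    filter_upwards [eventually_gt_atTop 0] with n hn
    exact PolyaTree.measure_compl_typicalEvent_le hP hlaw hindep hsize hC hn
  set F : ℝ → Filter (ℕ × S) := fun C => comap Prod.fst atTop ⊓
    𝓟 {p | p.2 ∈ PolyaTree.typicalEvent d NL K P X size C p.1} with hF
  have hfst : ∀ C, Tendsto Prod.fst (F C) atTop := fun C => tendsto_comap.mono_left inf_le_left
  have hev : ∀ C, ∀ᶠ p in F C, p.2 ∈ PolyaTree.typicalEvent d NL K P X size C p.1 :=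
    fun C => mem_inf_of_right (mem_principal_self _)
  have hgiven : ∀ C (T : PolyaTree.Tree d NL K), (∀ z, 0 < M.indicatorPrior T z) →
      Tendsto (fun p : ℕ × S => M.posteriorGivenTree (m := size p.1) (fun g i => X g i p.2) T
        (PolyaTree.correctStates P T)) (F C) (𝓝 1) := fun C T hT =>
    M.posteriorGivenTree_tendsto_one (P := P) (C := C) (m := fun p : ℕ × S => size p.1)
      (tendsto_natCast_atTop_atTop.comp (hfst C)) (fun g => (hζ g).1)
      (fun g => (hlim g).comp (hfst C)) ((hev C).mono fun p hp g j => hp.1 g j)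
      (fun A b g => PolyaTree.measureReal_rect_pos hP hpos T g _ _)
      (fun A b g => (hev C).mono fun p hp => (hp.2 T A b g).le) (hT _)
  refine ⟨fun T hT => PolyaTree.tendstoInMeasure_of_tendsto_on_events hG
    fun C _ => hgiven C T hT, fun hT => PolyaTree.tendstoInMeasure_of_tendsto_on_events hG
    fun C _ => ?_⟩
  exact M.posterior_tendsto_one hNL (m := fun p : ℕ × S => size p.1)
    ((hev C).mono fun p hp g j => hp.1 g j) (fun T => hT T (PolyaTree.trueDifference P T))
    fun T => hgiven C T (hT T)
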